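/- Let $q=2$, let $\mathbb C_\infty$ be the completion of an algebraic closure of $\mathbb F_2((1/\theta))$, and let $\operatorname{ord}$ be its valuation with $\operatorname{ord}\theta=-1$. Let $\mathbb C_\infty[T,\tau]$ be the ring of non-commutative polynomials with $Ta=aT$, $T\tau=\tau T$, $\tau a=a^2\tau$ for $a\in\mathbb C_\infty$, and let $\mathbb C_\infty\{T\}$ be the ring of power series $\sum_{i\ge0} a_iT^i$ with $a_i\in\mathbb C_\infty$, $a_i\to0$, on which $\tau$ acts by $\sum a_iT^i\mapsto\sum a_i^2T^i$. For a left $\mathbb C_\infty[T,\tau]$-module $M$ let $H^1(M)$ be the $\mathbb F_2[T]$-module of $\tau$-invariants of $M\otimes_{\mathbb C_\infty[T]}\mathbb C_\infty\{T\}$, where $\tau(m\otimes z)=\tau m\otimes\tau z$, and let $h^1(M)$ be its rank. For a $2\times2$ matrix $B$ over $\mathbb C_\infty$ let $M(B)$ be the t-motive that is free over the subring $\mathbb C_\infty\{\tau\}$ generated by $\mathbb C_\infty$ and $\tau$ on a basis $e_*=(e_1,e_2)^t$, with $Te_*=\theta e_*+B\tau e_*+\tau^2e_*$. Let $A=\begin{pmatrix}\theta&\theta^6\\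 \theta^{-2}&0\end{pmatrix}$, and let $(a_{ij})$ be the entries of the transposed matrix $A^t$, so that $a_{11}=\theta$, $a_{12}=\theta^{-2}$, $a_{21}=\theta^6$, $a_{22}=0$. The affine equation associated to $M(A^t)$ is the system, for $i=0,1,2,\dots$ (with $x_j=0$ for $j<0$), $$\frac{\theta^{q^3+q^2}}{a_{21}^{q^2}}x_i^{q^4}+\Bigl(\frac{a_{11}^{q^2}}{a_{21}^{q^2}}+\frac{a_{22}^q}{a_{21}^q}\Bigr)\theta^{q^2}x_i^{q^3}+\Bigl(\frac{\theta^q}{a_{21}}+\frac{\theta^{q^2}}{a_{21}^{q^2}}+\frac{a_{11}^qa_{22}^q}{a_{21}^q}-a_{12}^q\Bigr)x_i^{q^2}+\Bigl(\frac{a_{11}}{a_{21}}+\frac{a_{22}^q}{a_{21}^q}\Bigr)x_i^{q}+\frac1{a_{21}}x_i$$ $$-\frac{\theta^{q^3}+\theta^{q^2}}{a_{21}^{q^2}}x_{i-1}^{q^4}-\Bigl(\frac{a_{11}^{q^2}}{a_{21}^{q^2}}+\frac{a_{22}^q}{a_{21}^q}\Bigr)x_{i-1}^{q^3}-\Bigl(\frac1{a_{21}}+\frac1{a_{21}^{q^2}}\Bigr)x_{i-1}^{q^2}+\frac1{a_{21}^{q^2}}x_{i-2}^{q^4}=0$$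 in unknowns $x_0,x_1,\dots\in\mathbb C_\infty$, a solution being identified with the power series $\sum_{i\ge0} x_iT^i$. A solution is called small if it belongs to $\mathbb C_\infty\{T\}$, and it is called a minimal chain (generated by $x_0$) if for every $i>0$ the value $\operatorname{ord}x_i$ is the maximum of $\operatorname{ord}z$ over all $z\in\mathbb C_\infty$ that solve the $i$-th equation in place of $x_i$ for the given $x_0,\dots,x_{i-1}$. **Theorem.** $H^1(M(A^t))$ is a free $\mathbb F_2[T]$-module and $h^1(M(A^t))=1$. There is a minimal chain $\{x_1\}=\sum_{n\ge0}x_{1n}T^n$ of the affine equation with $\operatorname{ord}x_{10}=1$, and for every such minimal chain $\operatorname{ord}x_{1n}=4^n$ for all $n\ge0$ and the set of small solutions of the affine equation is exactly $\mathbb F_2[T]\cdot\{x_1\}$. -/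

import Mathlib

open scoped TensorProduct Polynomial PowerSeries LaurentSeries

noncomputable section

namespace Anderson

variable (F : Type) [Field F] [Fintype F]

/-! ### The field `C_∞` over a finite field `F = 𝔽_q` -/

/-- The field `K_∞ = 𝔽_q((1/θ))`, the completion of `𝔽_q(θ)` at infinity. The variable of the
Laurent series is `1/θ`. -/
abbrev KInfty : Type := F⸨X⸩

/-- The `1/θ`-adic valuation of `K_∞` has rank one; it is normalized by `|θ| = q`. -/
instance : (Valued.v : Valuation (KInfty F) (WithZero (Multiplicative ℤ))).RankOne :=
  have : (Valued.v : Valuation (KInfty F)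
      (WithZero (Multiplicative ℤ))).IsRankOneDiscrete :=
    Valuation.IsRankOneDiscrete.mk' ((PowerSeries.idealX F).valuation F⸨X⸩)
  Valuation.IsRankOneDiscrete.rankOne _ (e := (Fintype.card F : NNReal))
    (by exact_mod_cast Fintype.one_lt_card)

/-- The absolute value of `K_∞`. -/
instance : NontriviallyNormedField (KInfty F) :=
  Valued.toNontriviallyNormedField (L := KInfty F) (Γ₀ := WithZero (Multiplicative ℤ))

instance : IsUltrametricDist (KInfty F) :=
  inferInstance

/-- An algebraic closure of `K_∞`. -/
abbrev KInftyAlg : Type := AlgebraicClosure (KInfty F)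

/-- The absolute value of the algebraic closure of `K_∞`: the unique extension (the spectral norm)
of the absolute value of `K_∞`. -/
instance : NormedField (KInftyAlg F) := spectralNorm.normedField (KInfty F) (KInftyAlg F)

instance : NormedAlgebra (KInfty F) (KInftyAlg F) :=
  spectralNorm.normedAlgebra (KInfty F) (KInftyAlg F)

/-- The field `C_∞`: the completion of the algebraic closure of `K_∞`. -/
abbrev CInfty : Type := UniformSpace.Completion (KInftyAlg F)

instance : IsUltrametricDist (CInfty F) := IsUltrametricDist.of_normedAlgebra (KInfty F)

/-- `C_∞` as an extension of the field of constants `𝔽_q`. -/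
instance : Algebra F (CInfty F) :=
  ((algebraMap (KInftyAlg F) (CInfty F)).comp (algebraMap F (KInftyAlg F))).toAlgebra

/-- The element `θ` of `C_∞`, the inverse of the variable of `𝔽_q((1/θ))`. -/
def theta : CInfty F := algebraMap (KInfty F) (CInfty F) (HahnSeries.single (-1 : ℤ) (1 : F))

variable {F} in
/-- The valuation `ord` of `C_∞`, normalized by `ord θ = -1`, with `ord 0 = +∞`. -/
def ord (x : CInfty F) : WithTop ℝ :=
  open Classical in if x = 0 then ⊤ else ((-Real.logb ‖theta F‖ ‖x‖ : ℝ) : WithTop ℝ)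

/-- The `q`-Frobenius `a ↦ a ^ q` of `C_∞`. -/
def frob : CInfty F →+* CInfty F := (FiniteField.frobeniusAlgHom F (CInfty F)).toRingHom

theorem frob_apply (a : CInfty F) : frob F a = a ^ Fintype.card F := rfl

/-! ### The rings `C_∞{τ}`, `C_∞[T, τ]` and `C_∞{T}` -/

/-- The twist of `C_∞{τ}`: the `k`-th power of `τ` acts on constants by `a ↦ a ^ (q ^ k)`. -/
instance : MulSemiringAction (Multiplicative ℕ) (CInfty F) :=
  MulSemiringAction.compHom (CInfty F) (powersHom (CInfty F →+* CInfty F) (frob F))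

/-- The ring `C_∞{τ}` of non-commutative polynomials in `τ`, with `τ a = a ^ q τ`. -/
abbrev TwistedPolynomial : Type := SkewPolynomial (CInfty F)

/-- The Anderson ring `C_∞[T, τ]`: polynomials over `C_∞{τ}` in a variable `T` that commutes with
`C_∞` and with `τ`. -/
abbrev AndersonRing : Type := Polynomial (TwistedPolynomial F)

/-- The element `τ` of the Anderson ring. -/
def tau : AndersonRing F := Polynomial.C SkewPolynomial.X

/-- The inclusion of `C_∞[T]` into `C_∞[T, τ]`. -/
def polyIncl : (CInfty F)[X] →+* AndersonRing F :=
  Polynomial.mapRingHom SkewPolynomial.CRingHom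

/-- The action `∑ a_i T^i ↦ ∑ a_i ^ q T^i` of `τ` on `C_∞[T]`. -/
def polyFrob : (CInfty F)[X] →+* (CInfty F)[X] := Polynomial.mapRingHom (frob F)

theorem tau_mul_C (a : CInfty F) :
    tau F * Polynomial.C (SkewPolynomial.CRingHom a) =
      Polynomial.C (SkewPolynomial.CRingHom (a ^ Fintype.card F)) * tau F := by
  have h : ((SkewPolynomial.φ : CInfty F →+* CInfty F) a) = a ^ Fintype.card F := rfl
  have h' : (SkewPolynomial.X : TwistedPolynomial F) * SkewPolynomial.C a =
      SkewPolynomial.C (a ^ Fintype.card F) * SkewPolynomial.X := by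
    change SkewPolynomial.X * SkewPolynomial.monomial 0 a = SkewPolynomial.monomial 0 _ * _
    rw [SkewPolynomial.X_mul_monomial, h, SkewPolynomial.monomial_mul_X]
  simp only [tau, ← Polynomial.C_mul, SkewPolynomial.CRingHom_eq_C, h']

theorem tau_mul_polyIncl (p : (CInfty F)[X]) :
    tau F * polyIncl F p = polyIncl F (polyFrob F p) * tau F := by
  induction p using Polynomial.induction_on' with
  | add p q hp hq => simp only [map_add, mul_add, add_mul, hp, hq]
  | monomial k a =>
    simp only [polyIncl, polyFrob, Polynomial.coe_mapRingHom, Polynomial.map_monomial]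
    rw [← Polynomial.C_mul_X_pow_eq_monomial, ← Polynomial.C_mul_X_pow_eq_monomial, ← mul_assoc,
      tau_mul_C, frob_apply, mul_assoc, mul_assoc, Polynomial.X_pow_mul]

/-- The ring `C_∞{T}` of the power series `∑ a_i T^i` over `C_∞` such that `a_i → 0`. -/
abbrev TateAlg : Subring (CInfty F)⟦X⟧ := PowerSeries.IsRestricted.subring (R := CInfty F) 1

theorem mem_tateAlg {f : (CInfty F)⟦X⟧} : f ∈ TateAlg F ↔
    Filter.Tendsto (fun i => PowerSeries.coeff i f) Filter.atTop (nhds 0) := by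
  refine Iff.trans (PowerSeries.isRestricted_iff' 1 f) ?_
  simp only [one_pow, mul_one]
  exact tendsto_zero_iff_norm_tendsto_zero.symm

/-- `C_∞{T}` as an algebra over `C_∞[T]`. -/
instance : Algebra (CInfty F)[X] (TateAlg F) :=
  ((algebraMap (CInfty F)[X] (CInfty F)⟦X⟧).codRestrict (TateAlg F) fun p => by
    rw [mem_tateAlg]
    refine tendsto_const_nhds.congr' ?_
    filter_upwards [Filter.eventually_gt_atTop p.natDegree] with i hi
    simp [PowerSeries.algebraMap_apply', Polynomial.coeff_eq_zero_of_natDegree_lt hi]).toAlgebra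

/-- The action `∑ a_i T^i ↦ ∑ a_i ^ q T^i` of `τ` on `C_∞{T}`, semilinear over the action of `τ`
on `C_∞[T]`. -/
def tateTau : TateAlg F →ₛₗ[polyFrob F] TateAlg F where
  toFun z := ⟨PowerSeries.map (frob F) z, by
    have h := ((mem_tateAlg F).1 z.2).pow (Fintype.card F)
    rw [zero_pow Fintype.card_ne_zero] at h
    rw [mem_tateAlg]
    simpa [frob_apply] using h⟩
  map_add' x y := by
    ext1
    simp
  map_smul' p x := by
    ext1
    change PowerSeries.map (frob F) (algebraMap (CInfty F)[X] (CInfty F)⟦X⟧ p * x) =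
      algebraMap (CInfty F)[X] (CInfty F)⟦X⟧ (polyFrob F p) * PowerSeries.map (frob F) x
    rw [map_mul]
    congr 1
    ext i
    simp [PowerSeries.algebraMap_apply', polyFrob]

/-! ### The cohomology `H^1(M)` of a left `C_∞[T, τ]`-module -/

section Cohomology

variable (M : Type) [AddCommGroup M] [Module (AndersonRing F) M]

/-- A left `C_∞[T, τ]`-module `M`, considered as a `C_∞[T]`-module. -/
def Restr : Type := M

instance : AddCommGroup (Restr M) := inferInstanceAs (AddCommGroup M)

instance : Module (AndersonRing F) (Restr M) := inferInstanceAs (Module (AndersonRing F) M)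

instance : Module (CInfty F)[X] (Restr M) := Module.compHom M (polyIncl F)

/-- The action of `τ` on `M`, semilinear over the action of `τ` on `C_∞[T]`. -/
def moduleTau : Restr M →ₛₗ[polyFrob F] Restr M where
  toFun m := tau F • m
  map_add' x y := smul_add (tau F) x y
  map_smul' p x := by
    change tau F • (polyIncl F p • x) = polyIncl F (polyFrob F p) • (tau F • x)
    rw [← mul_smul, ← mul_smul, tau_mul_polyIncl]

/-- `M{T} = M ⊗ C_∞{T}`, the tensor product over `C_∞[T]`. -/
def TateModule : Type := Restr M ⊗[(CInfty F)[X]] TateAlg F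

instance : AddCommGroup (TateModule F M) :=
  inferInstanceAs (AddCommGroup (Restr M ⊗[(CInfty F)[X]] TateAlg F))

instance : Module (CInfty F)[X] (TateModule F M) :=
  inferInstanceAs (Module (CInfty F)[X] (Restr M ⊗[(CInfty F)[X]] TateAlg F))

/-- The inclusion of `𝔽_q[T]` into `C_∞[T]`. -/
def constIncl : F[X] →+* (CInfty F)[X] := Polynomial.mapRingHom (algebraMap F (CInfty F))

theorem polyFrob_constIncl (p : F[X]) : polyFrob F (constIncl F p) = constIncl F p := by
  ext i
  simp [polyFrob, constIncl, frob_apply, ← map_pow, FiniteField.pow_card]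

instance : Module F[X] (TateModule F M) := Module.compHom _ (constIncl F)

/-- The action of `τ` on `M{T}`: `τ (m ⊗ z) = τ m ⊗ τ z`. -/
def tateModuleTau : TateModule F M →ₛₗ[polyFrob F] TateModule F M :=
  TensorProduct.map (moduleTau F M) (tateTau F)

/-- `H^1(M)`, the `𝔽_q[T]`-module of the elements of `M{T}` that are fixed by `τ`. -/
def H1 : Submodule F[X] (TateModule F M) where
  carrier := {y | tateModuleTau F M y = y}
  add_mem' {x y} hx hy := (map_add (tateModuleTau F M) x y).trans (congrArg₂ (· + ·) hx hy)
  zero_mem' := map_zero (tateModuleTau F M)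
  smul_mem' p y hy := by
    change tateModuleTau F M (constIncl F p • y) = constIncl F p • y
    rw [LinearMap.map_smulₛₗ, polyFrob_constIncl, hy]

/-- `h^1(M)`, the dimension of `H^1(M)` over `𝔽_q[T]`. -/
def h1 : ℕ := Module.finrank F[X] (H1 F M)

end Cohomology

/-! ### The t-motives `M(A, N)` -/

section TMotive

variable {F} {n : ℕ}

/-- The matrix `(θ + N) + A τ + τ ^ 2` over `C_∞{τ}`. -/
def actionMatrix (A N : Matrix (Fin n) (Fin n) (CInfty F)) :
    Matrix (Fin n) (Fin n) (TwistedPolynomial F) := fun i j =>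
  SkewPolynomial.monomial 0 ((theta F • (1 : Matrix (Fin n) (Fin n) (CInfty F)) + N) i j) +
    SkewPolynomial.monomial 1 (A i j) +
    SkewPolynomial.monomial 2 ((1 : Matrix (Fin n) (Fin n) (CInfty F)) i j)

/-- The t-motive `M(A, N)`: the left `C_∞{τ}`-module that is free on the basis `e_1, …, e_n` (the
standard basis of row vectors), with the action of `T` given on the column `e_*` of the basis
elements by `T e_* = (θ + N) e_* + A τ e_* + τ ^ 2 e_*`. -/
def TMotive (_A _N : Matrix (Fin n) (Fin n) (CInfty F)) : Type := Fin n → TwistedPolynomial F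

variable (A N : Matrix (Fin n) (Fin n) (CInfty F))

instance : AddCommGroup (TMotive A N) := inferInstanceAs (AddCommGroup (Fin n → TwistedPolynomial F))

/-- The action of `C_∞[T, τ]` on `M(A, N)`: `C_∞{τ}` acts on row vectors by multiplication on the
left, and `T` acts by multiplication on the right with the matrix `(θ + N) + A τ + τ ^ 2`. -/
def actionHom : AndersonRing F →+* AddMonoid.End (Fin n → TwistedPolynomial F) :=
  Polynomial.eval₂RingHom'
    (Module.toAddMonoidEnd (TwistedPolynomial F) (Fin n → TwistedPolynomial F))
    (Matrix.vecMulLinear (actionMatrix A N)).toAddMonoidHom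
    fun a => by
      ext v : 1
      exact ((Matrix.vecMulLinear (actionMatrix A N)).map_smul a v).symm

instance : Module (AndersonRing F) (TMotive A N) :=
  Module.compHom (Fin n → TwistedPolynomial F) (actionHom A N)

end TMotive

/-! ### Affine equations -/

/-- The coefficients of an affine equation: the head is `∑_{γ ≤ r} a_γ x_i ^ (q ^ γ)`, and the tail
is `∑_{1 ≤ β ≤ n} ∑_{γ ≤ κ_β} b_{βγ} x_{i-β} ^ (q ^ γ)`. -/
structure AffineEquation where
  r : ℕ
  n : ℕ
  κ : ℕ → ℕ
  a : ℕ → CInfty F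
  b : ℕ → ℕ → CInfty F

namespace AffineEquation

variable {F} (E : AffineEquation F)

/-- The left hand side of the `i`-th affine equation, where `x_j = 0` for `j < 0`. -/
def lhs (x : ℕ → CInfty F) (i : ℕ) : CInfty F :=
  ∑ γ ∈ Finset.range (E.r + 1), E.a γ * x i ^ (Fintype.card F ^ γ) +
    ∑ β ∈ Finset.Icc 1 E.n, ∑ γ ∈ Finset.range (E.κ β + 1),
      E.b β γ * (if β ≤ i then x (i - β) else 0) ^ (Fintype.card F ^ γ)

/-- A solution `{x} = ∑ x_i T^i` of the system of all the `i`-th affine equations. -/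
def IsSolution (x : (CInfty F)⟦X⟧) : Prop := ∀ i, E.lhs (fun j => PowerSeries.coeff j x) i = 0

/-- The small solutions: those that belong to `C_∞{T}`. -/
def smallSolutions : Set (CInfty F)⟦X⟧ := {x | E.IsSolution x ∧ x ∈ TateAlg F}

/-- A minimal chain (generated by its coefficient `x_0`): a solution such that for all `i > 0`,
`ord x_i` is the maximum of the ord's of the solutions of the `i`-th equation for the fixed
`x_0, …, x_{i-1}`. -/
def IsMinimalChain (x : (CInfty F)⟦X⟧) : Prop :=
  E.IsSolution x ∧ ∀ i > 0, ∀ z : CInfty F,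
    E.lhs (Function.update (fun j => PowerSeries.coeff j x) i z) i = 0 →
      ord z ≤ ord (PowerSeries.coeff i x)

end AffineEquation

variable {F} in
/-- The affine equation associated to `M(A, ε N_0)` for a `2 × 2` matrix `A` with `a_21 ≠ 0`, where
`N_0` has the entry `1` at `(1, 2)` and zeros elsewhere: it is obtained by elimination
of all unknowns but `x = y_21` from the equation `Y^{(1)} Q = Y` that defines `H^1`. -/
def affineEquation (A : Matrix (Fin 2) (Fin 2) (CInfty F)) (ε : CInfty F) : AffineEquation F :=
  let q := Fintype.card F
  let θ := theta F
  let a₁₁ := A 0 0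
  let a₁₂ := A 0 1
  let a₂₁ := A 1 0
  let a₂₂ := A 1 1
  { r := 4
    n := 2
    κ := fun _ => 4
    a := fun γ => match γ with
      | 0 => 1 / a₂₁
      | 1 => a₁₁ / a₂₁ + a₂₂ ^ q / a₂₁ ^ q
      | 2 => θ ^ q / a₂₁ + θ ^ q ^ 2 / a₂₁ ^ q ^ 2 + a₁₁ ^ q * a₂₂ ^ q / a₂₁ ^ q - a₁₂ ^ q
      | 3 => (a₁₁ ^ q ^ 2 / a₂₁ ^ q ^ 2 + a₂₂ ^ q / a₂₁ ^ q) * θ ^ q ^ 2 - ε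
      | 4 => θ ^ (q ^ 3 + q ^ 2) / a₂₁ ^ q ^ 2
      | _ => 0
    b := fun β γ => match β, γ with
      | 1, 2 => -(1 / a₂₁ + 1 / a₂₁ ^ q ^ 2)
      | 1, 3 => -(a₁₁ ^ q ^ 2 / a₂₁ ^ q ^ 2 + a₂₂ ^ q / a₂₁ ^ q)
      | 1, 4 => -((θ ^ q ^ 3 + θ ^ q ^ 2) / a₂₁ ^ q ^ 2)
      | 2, 4 => 1 / a₂₁ ^ q ^ 2
      | _, _ => 0 }

/-- The field `𝔽_2`. -/
abbrev F2 : Type := ZMod 2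

/-- The matrix `A` with rows `(θ, θ ^ 6)` and `(θ ^ (-2), 0)`, for `q = 2`. -/
def exampleMatrix : Matrix (Fin 2) (Fin 2) (CInfty F2) :=
  !![theta F2, theta F2 ^ 6; (theta F2 ^ 2)⁻¹, 0]

end Anderson

end

open scoped TensorProduct Polynomial PowerSeries LaurentSeries

noncomputable section

namespace Anderson

/-! ### Absolute value, `ord` and Frobenius of `C_∞`. -/

section CInfty

variable (F : Type) [Field F] [Fintype F]

/-! Multiplied by `θ ^ 24`, the `i`-th affine equation reads `head (x_i) + tailOne (x_{i-1}) +
x_{i-2} ^ 16 = 0`, where `head` is additive in characteristic 2. The Newton polygon of `head` has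
two slopes: there is one root of absolute value `1/2`, close to `θ⁻¹`, and the other nonzero roots
have absolute value `√2`. On the disc `‖x‖ < 1/2` the linear term dominates, so `head` is injective
there and scales norms by `2 ^ 18`; by a contraction argument it reaches from this disc every value
of norm below `2 ^ 17` (`exists_head_eq`).

The tail is dominated by `θ ^ 18 * x_{i-1} ^ 4`. Starting from the root of norm `1/2` and always
choosing the solution in the small disc gives a chain with `‖x_i‖ = ‖x_{i-1}‖ ^ 4`, hence `ord x_n =
4 ^ n`; minimality amounts to this choice. If instead `‖x_0‖ = √2`, the tail has norm exactly `2 ^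
20`, which forces `‖x_i‖ = √2` for all `i` (`norm_sq_eq_two`), so such a solution is never small. A
small solution therefore starts with `0` or with the root of norm `1/2`; subtracting `0` or the
chain and dividing by `T` lowers the index from which its coefficients are below `1/2`, and
induction writes it as an `𝔽_2[T]`-multiple of the chain (`IsChain.exists_smul_eq`).

For `H^1`, the motive is free over `C_∞[T]` on `e_j, τ e_j` (`coordsEquiv`), so `τ`-invariance
becomes a system for four series in `C_∞{T}`. Eliminating all but the coordinate at `τ e_1` leaves
the affine equation. Since Frobenius is bijective on `C_∞{T}`, this coordinate identifies `H^1` with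
the small solutions (`coordH1_injective`, `range_coordH1`), a free module of rank one. -/

theorem norm_theta : ‖theta F‖ = Fintype.card F := by
  have : (Valued.v : Valuation (KInfty F) (WithZero (Multiplicative ℤ))).IsRankOneDiscrete :=
    Valuation.IsRankOneDiscrete.mk' ((PowerSeries.idealX F).valuation F⸨X⸩)
  rw [theta, norm_algebraMap']
  change ((WithZeroMulInt.toNNReal (e := (Fintype.card F : NNReal))
    (by exact_mod_cast Fintype.card_ne_zero)
      (Valuation.IsRankOneDiscrete.valueGroup₀_equiv_withZeroMulInt
    (Valued.v : Valuation (KInfty F) (WithZero (Multiplicative ℤ)))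
      ((Valued.v : Valuation (KInfty F) (WithZero (Multiplicative ℤ))).restrict _)) : NNReal) : ℝ)
    = _
  rw [Valuation.IsRankOneDiscrete.valueGroup₀_equiv_withZeroMulInt_restrict_apply_of_surjective
    (LaurentSeries.valuation_surjective F), LaurentSeries.valuation_single_zpow]
  rw [WithZeroMulInt.toNNReal_neg_apply _ WithZero.exp_ne_zero]
  simp [WithZero.exp]

theorem theta_ne_zero : theta F ≠ 0 := by
  rw [← norm_pos_iff, norm_theta]
  exact_mod_cast Fintype.card_pos

/-- The `q`-Frobenius of `C_∞` is surjective: its image is closed and contains the algebraic closure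
of `K_∞`. -/
theorem frob_surjective : Function.Surjective (frob F) := by
  have hnorm : ∀ x y : CInfty F, dist (frob F x) (frob F y) = dist x y ^ Fintype.card F := by
    intro x y
    rw [dist_eq_norm, dist_eq_norm, ← map_sub, frob_apply, norm_pow]
  have hq : Fintype.card F ≠ 0 := Fintype.card_ne_zero
  -- Frobenius raises distances to the power `q`, so it is a uniform embedding of a complete space
  -- and its range is complete.
  have hclosed : IsClosed (Set.range (frob F)) := by
    have hui : IsUniformInducing (frob F) := by
      rw [Metric.isUniformInducing_iff]
      constructor
      · rw [Metric.uniformContinuous_iff]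
        intro ε hε
        -- The bound by `1` gives `d ^ q ≤ d` for the distance `d`.
        refine ⟨min ε 1, by positivity, fun {a b} h => ?_⟩
        rw [hnorm]
        have h1 : dist a b ≤ 1 := (h.trans_le (min_le_right _ _)).le
        exact (pow_le_of_le_one dist_nonneg h1 hq).trans_lt (h.trans_le (min_le_left _ _))
      · intro δ hδ
        refine ⟨δ ^ Fintype.card F, by positivity, fun {a b} h => ?_⟩
        rw [hnorm] at h
        exact lt_of_pow_lt_pow_left₀ _ hδ.le h
    exact hui.isComplete_range.isClosed
  have hdense : DenseRange (algebraMap (KInftyAlg F) (CInfty F)) :=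
    UniformSpace.Completion.denseRange_coe
  intro y
  have hsub : Set.range (algebraMap (KInftyAlg F) (CInfty F)) ⊆ Set.range (frob F) := by
    rintro _ ⟨a, rfl⟩
    obtain ⟨b, hb⟩ := IsAlgClosed.exists_pow_nat_eq a (Fintype.card_pos (α := F))
    exact ⟨algebraMap _ _ b, by rw [frob_apply, ← map_pow, hb]⟩
  exact hclosed.closure_subset_iff.2 hsub (hdense y)

instance : CharP (CInfty F2) 2 :=
  charP_of_injective_algebraMap (algebraMap F2 (CInfty F2)).injective 2

theorem norm_theta_two : ‖theta F2‖ = 2 := by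
  rw [norm_theta]
  simp

theorem frob_two (x : CInfty F2) : frob F2 x = x ^ 2 := by
  rw [frob_apply]
  simp

theorem ord_eq_iff {x : CInfty F2} {r : ℝ} : ord x = r ↔ ‖x‖ = 2 ^ (-r) := by
  unfold ord
  split_ifs with h
  · simp only [h, norm_zero]
    constructor
    · intro h
      cases h
    · intro h
      have : (0 : ℝ) < 2 ^ (-r) := by positivity
      linarith
  · have hx : 0 < ‖x‖ := norm_pos_iff.2 h
    rw [WithTop.coe_eq_coe, norm_theta_two, neg_eq_iff_eq_neg,
      Real.logb_eq_iff_rpow_eq (by norm_num) (by norm_num) hx, eq_comm]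

theorem ord_le_ord_iff {x y : CInfty F2} : ord x ≤ ord y ↔ ‖y‖ ≤ ‖x‖ := by
  unfold ord
  split_ifs with h h' h'
  · simp [h, h']
  · simpa [h] using h'
  · simp [h']
  · have hx : 0 < ‖x‖ := norm_pos_iff.2 h
    have hy : 0 < ‖y‖ := norm_pos_iff.2 h'
    rw [WithTop.coe_le_coe, norm_theta_two, neg_le_neg_iff,
      Real.logb_le_logb (by norm_num) hy hx]

end CInfty

/-! ### Newton polygon of the head, over any ultrametric field with `‖θ‖ = 2`. -/

section Newton

variable {K : Type} [NormedField K] {θ : K}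

theorem ne_zero_of_norm_eq_two (hθ : ‖θ‖ = 2) : θ ≠ 0 := by
  rw [← norm_pos_iff, hθ]
  norm_num

theorem norm_theta_pow_mul_pow (hθ : ‖θ‖ = 2) (m n : ℕ) (x : K) :
    ‖θ ^ m * x ^ n‖ = 2 ^ m * ‖x‖ ^ n := by
  rw [norm_mul, norm_pow, norm_pow, hθ]

theorem norm_inv_theta (hθ : ‖θ‖ = 2) : ‖θ⁻¹‖ = 1 / 2 := by
  rw [norm_inv, hθ, one_div]

/-- The head of the affine equation, multiplied by `θ ^ 24`. -/
def head (θ x : K) : K :=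
  θ ^ 18 * x ^ 1 + (θ ^ 19 * x ^ 2 + θ ^ 4 * x ^ 4 + θ ^ 8 * x ^ 8 +
    θ ^ 12 * x ^ 16)

/-- The part of degree `1` in `T` of the affine equation, multiplied by `θ ^ 24`. -/
def tailOne (θ y : K) : K :=
  -((θ ^ 18 + 1) * y ^ 4 + θ ^ 4 * y ^ 8 + (θ ^ 8 + θ ^ 4) * y ^ 16)

@[simp]
theorem head_zero : head θ 0 = 0 := by
  simp [head]

section Ultrametric

variable [IsUltrametricDist K]

theorem norm_add_eq_left_of_lt {a b : K} (h : ‖b‖ < ‖a‖) : ‖a + b‖ = ‖a‖ := by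
  rw [IsUltrametricDist.norm_add_eq_max_of_norm_ne_norm h.ne', max_eq_left h.le]

theorem norm_add_lt_of_lt {a b : K} {r : ℝ} (ha : ‖a‖ < r) (hb : ‖b‖ < r) :
    ‖a + b‖ < r :=
  (IsUltrametricDist.norm_add_le_max a b).trans_lt (max_lt ha hb)

theorem norm_sub_le_max' (a b : K) : ‖a - b‖ ≤ max ‖a‖ ‖b‖ := by
  rw [sub_eq_add_neg, ← norm_neg b]
  exact IsUltrametricDist.norm_add_le_max _ _

/-- First vertex of the Newton polygon: below `1/2` the term `θ ^ 18 * x` beats `θ ^ 19 * x ^ 2` and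
all higher ones. The next lemmas treat the ranges up to and beyond `√2`, where the terms of degree 2
and 16 take over. -/
theorem norm_head_of_lt (hθ : ‖θ‖ = 2) {x : K} (hx : ‖x‖ < 1 / 2) : ‖head θ x‖ = 2 ^ 18 * ‖x‖ := by
  rcases eq_or_ne x 0 with rfl | h0
  · simp
  have hr : 0 < ‖x‖ := norm_pos_iff.2 h0
  have hle : ∀ n : ℕ, n ≠ 0 → ‖x‖ ^ n ≤ ‖x‖ := fun n hn =>
    pow_le_of_le_one hr.le (by linarith) hn
  rw [head, norm_add_eq_left_of_lt, norm_theta_pow_mul_pow hθ, pow_one]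
  rw [norm_theta_pow_mul_pow hθ 18, pow_one]
  refine norm_add_lt_of_lt (norm_add_lt_of_lt (norm_add_lt_of_lt ?_ ?_) ?_) ?_ <;>
    rw [norm_theta_pow_mul_pow hθ]
  · nlinarith
  · linarith [hle 4 (by norm_num)]
  · linarith [hle 8 (by norm_num)]
  · linarith [hle 16 (by norm_num)]

/-- The bound `2 ^ 20` is the common value of `2 ^ 19 * r ^ 2` and `2 ^ 12 * r ^ 16` at the break
point `r ^ 2 = 2`. -/
theorem norm_head_lt (hθ : ‖θ‖ = 2) {x : K} (hx : ‖x‖ ^ 2 < 2) : ‖head θ x‖ < 2 ^ 20 := by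
  have hr : ‖x‖ < 3 / 2 := by nlinarith [norm_nonneg x]
  have h4 : ‖x‖ ^ 4 < 4 := by
    rw [show ‖x‖ ^ 4 = (‖x‖ ^ 2) ^ 2 by ring]
    exact (pow_lt_pow_left₀ hx (by positivity) (by norm_num)).trans_eq (by norm_num)
  have h8 : ‖x‖ ^ 8 < 16 := by
    rw [show ‖x‖ ^ 8 = (‖x‖ ^ 2) ^ 4 by ring]
    exact (pow_lt_pow_left₀ hx (by positivity) (by norm_num)).trans_eq (by norm_num)
  have h16 : ‖x‖ ^ 16 < 256 := by
    rw [show ‖x‖ ^ 16 = (‖x‖ ^ 2) ^ 8 by ring]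
    exact (pow_lt_pow_left₀ hx (by positivity) (by norm_num)).trans_eq (by norm_num)
  refine norm_add_lt_of_lt ?_
    (norm_add_lt_of_lt (norm_add_lt_of_lt (norm_add_lt_of_lt ?_ ?_) ?_) ?_) <;>
    rw [norm_theta_pow_mul_pow hθ] <;> linarith

theorem norm_head_of_half_lt (hθ : ‖θ‖ = 2) {x : K} (hx : 1 / 2 < ‖x‖) (hx' : ‖x‖ ^ 2 < 2) :
    ‖head θ x‖ = 2 ^ 19 * ‖x‖ ^ 2 := by
  have hr : ‖x‖ < 3 / 2 := by nlinarith [norm_nonneg x]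
  have hs : 0 < ‖x‖ ^ 2 := by positivity
  have h4 : ‖x‖ ^ 4 < 2 * ‖x‖ ^ 2 := by
    rw [show ‖x‖ ^ 4 = ‖x‖ ^ 2 * ‖x‖ ^ 2 by ring]
    exact mul_lt_mul_of_pos_right hx' hs
  have h8 : ‖x‖ ^ 8 < 8 * ‖x‖ ^ 2 := by
    rw [show ‖x‖ ^ 8 = (‖x‖ ^ 2) ^ 3 * ‖x‖ ^ 2 by ring]
    exact mul_lt_mul_of_pos_right
      ((pow_lt_pow_left₀ hx' (by positivity) (by norm_num)).trans_eq (by norm_num)) hs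
  have h16 : ‖x‖ ^ 16 < 128 * ‖x‖ ^ 2 := by
    rw [show ‖x‖ ^ 16 = (‖x‖ ^ 2) ^ 7 * ‖x‖ ^ 2 by ring]
    exact mul_lt_mul_of_pos_right
      ((pow_lt_pow_left₀ hx' (by positivity) (by norm_num)).trans_eq (by norm_num)) hs
  rw [head, show ∀ a b c d e : K, a + (b + c + d + e) = b + (a + c + d + e) by
      intros; ring, norm_add_eq_left_of_lt, norm_theta_pow_mul_pow hθ]
  rw [norm_theta_pow_mul_pow hθ 19]
  refine norm_add_lt_of_lt (norm_add_lt_of_lt (norm_add_lt_of_lt ?_ ?_) ?_) ?_ <;>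
    rw [norm_theta_pow_mul_pow hθ] <;> nlinarith

theorem norm_head_of_two_lt (hθ : ‖θ‖ = 2) {x : K} (hx : 2 < ‖x‖ ^ 2) :
    ‖head θ x‖ = 2 ^ 12 * ‖x‖ ^ 16 := by
  have hr : 1 < ‖x‖ := by nlinarith [norm_nonneg x]
  have hs : 0 < ‖x‖ ^ 2 := by positivity
  have h4 : 2 ^ 6 * ‖x‖ ^ 4 < ‖x‖ ^ 16 := by
    rw [show ‖x‖ ^ 16 = (‖x‖ ^ 2) ^ 6 * ‖x‖ ^ 4 by ring]
    exact mul_lt_mul_of_pos_right (pow_lt_pow_left₀ hx (by norm_num) (by norm_num)) (by positivity)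
  have h8 : 2 ^ 4 * ‖x‖ ^ 8 < ‖x‖ ^ 16 := by
    rw [show ‖x‖ ^ 16 = (‖x‖ ^ 2) ^ 4 * ‖x‖ ^ 8 by ring]
    exact mul_lt_mul_of_pos_right (pow_lt_pow_left₀ hx (by norm_num) (by norm_num)) (by positivity)
  have h2 : 2 ^ 7 * ‖x‖ ^ 2 < ‖x‖ ^ 16 := by
    rw [show ‖x‖ ^ 16 = (‖x‖ ^ 2) ^ 7 * ‖x‖ ^ 2 by ring]
    exact mul_lt_mul_of_pos_right (pow_lt_pow_left₀ hx (by norm_num) (by norm_num)) (by positivity)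
  rw [head, show ∀ a b c d e : K, a + (b + c + d + e) = e + (a + b + c + d) by
      intros; ring, norm_add_eq_left_of_lt, norm_theta_pow_mul_pow hθ]
  rw [norm_theta_pow_mul_pow hθ 12]
  refine norm_add_lt_of_lt (norm_add_lt_of_lt (norm_add_lt_of_lt ?_ ?_) ?_) ?_ <;>
    rw [norm_theta_pow_mul_pow hθ] <;> nlinarith

/-- The term `θ ^ 18 * y ^ 4` dominates as long as `‖y‖ ≤ √2`, a range that covers both the small
chains and the solutions of constant norm `√2`. -/
theorem norm_tail (hθ : ‖θ‖ = 2) {y z : K} (hy : y ≠ 0) (hy' : ‖y‖ ^ 2 ≤ 2)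
    (hz : ‖z‖ ^ 16 < 2 ^ 18 * ‖y‖ ^ 4) : ‖tailOne θ y + z ^ 16‖ = 2 ^ 18 * ‖y‖ ^ 4 := by
  have hr : 0 < ‖y‖ := norm_pos_iff.2 hy
  have h4 : 0 < ‖y‖ ^ 4 := by positivity
  have h8 : ‖y‖ ^ 8 ≤ 4 * ‖y‖ ^ 4 := by
    rw [show ‖y‖ ^ 8 = (‖y‖ ^ 2) ^ 2 * ‖y‖ ^ 4 by ring]
    exact mul_le_mul_of_nonneg_right
      ((pow_le_pow_left₀ (by positivity) hy' _).trans_eq (by norm_num)) h4.le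
  have h16 : ‖y‖ ^ 16 ≤ 64 * ‖y‖ ^ 4 := by
    rw [show ‖y‖ ^ 16 = (‖y‖ ^ 2) ^ 6 * ‖y‖ ^ 4 by ring]
    exact mul_le_mul_of_nonneg_right
      ((pow_le_pow_left₀ (by positivity) hy' _).trans_eq (by norm_num)) h4.le
  -- Factors `θ ^ 0` bring every term to the shape `θ ^ m * y ^ n`, so that one norm formula serves
  -- for all.
  have heq : tailOne θ y + z ^ 16 = -(θ ^ 18 * y ^ 4) + (-(θ ^ 0 * y ^ 4) +
      -(θ ^ 4 * y ^ 8) + -(θ ^ 8 * y ^ 16) + -(θ ^ 4 * y ^ 16) +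
      θ ^ 0 * z ^ 16) := by
    simp only [tailOne]
    ring
  rw [heq, norm_add_eq_left_of_lt, norm_neg, norm_theta_pow_mul_pow hθ]
  rw [norm_neg, norm_theta_pow_mul_pow hθ 18]
  refine norm_add_lt_of_lt (norm_add_lt_of_lt (norm_add_lt_of_lt
    (norm_add_lt_of_lt ?_ ?_) ?_) ?_) ?_ <;> simp only [norm_neg, norm_theta_pow_mul_pow hθ] <;>
    linarith

/-- Away from the break points a single term dominates, so `head` cannot vanish there. -/
theorem norm_sq_of_head_eq_zero (hθ : ‖θ‖ = 2) {x : K} (h : head θ x = 0) (hx : 1 / 2 < ‖x‖) :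
    ‖x‖ ^ 2 = 2 := by
  have hpos : 0 < ‖x‖ := by linarith
  rcases lt_trichotomy (‖x‖ ^ 2) 2 with hlt | heq | hgt
  · have := norm_head_of_half_lt hθ hx hlt
    rw [h, norm_zero] at this
    have : 0 < ‖x‖ ^ 2 := by positivity
    linarith
  · exact heq
  · have := norm_head_of_two_lt hθ hgt
    rw [h, norm_zero] at this
    have : 0 < ‖x‖ ^ 16 := by positivity
    linarith

theorem norm_sq_of_norm_head_eq (hθ : ‖θ‖ = 2) {x : K} (h : ‖head θ x‖ = 2 ^ 20) : ‖x‖ ^ 2 = 2 := by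
  rcases lt_trichotomy (‖x‖ ^ 2) 2 with hlt | heq | hgt
  · exact absurd h (norm_head_lt hθ hlt).ne
  · exact heq
  · have h' := norm_head_of_two_lt hθ hgt
    have : (2 : ℝ) ^ 8 < (‖x‖ ^ 2) ^ 8 := pow_lt_pow_left₀ hgt (by norm_num) (by norm_num)
    rw [← pow_mul] at this
    norm_num at this h h'
    linarith

end Ultrametric

variable [CharP K 2]

theorem add_pow_two_pow (x y : K) :
    (x + y) ^ 2 = x ^ 2 + y ^ 2 ∧ (x + y) ^ 4 = x ^ 4 + y ^ 4 ∧ (x + y) ^ 8 = x ^ 8 + y ^ 8 ∧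
      (x + y) ^ 16 = x ^ 16 + y ^ 16 :=
  ⟨add_pow_char_pow x y (p := 2) (n := 1), add_pow_char_pow x y (p := 2) (n := 2),
    add_pow_char_pow x y (p := 2) (n := 3), add_pow_char_pow x y (p := 2) (n := 4)⟩

theorem head_add (x y : K) : head θ (x + y) = head θ x + head θ y := by
  obtain ⟨h2, h4, h8, h16⟩ := add_pow_two_pow x y
  simp only [head, h2, h4, h8, h16]
  ring

theorem head_sub (x y : K) : head θ (x - y) = head θ x - head θ y := by
  rw [eq_sub_iff_add_eq, ← head_add, sub_add_cancel]

variable [IsUltrametricDist K]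

/-- The head takes every value of absolute value less than `2 ^ 17` at a point of absolute value
less than `1 / 2`. -/
theorem exists_head_eq [CompleteSpace K] (hθ : ‖θ‖ = 2) {d : K} (hd : ‖d‖ < 2 ^ 17) :
    ∃ x, head θ x = d ∧ ‖x‖ < 1 / 2 := by
  have h0 := ne_zero_of_norm_eq_two hθ
  have hθi : ∀ n : ℕ, ‖θ⁻¹ ^ n‖ = (1 / 2) ^ n := fun n => by
    rw [norm_pow, norm_inv, hθ, one_div]
  obtain ⟨r, hr0, hr, hdr⟩ : ∃ r : ℝ, 0 < r ∧ r < 1 / 2 ∧ ‖d‖ ≤ 2 ^ 18 * r := by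
    -- The midpoint of `‖d‖ / 2 ^ 18` and `1 / 2`.
    refine ⟨(‖d‖ / 2 ^ 17 + 1) / 4, by positivity, ?_, ?_⟩ <;> linarith [norm_nonneg d]
  -- Division by the linear coefficient turns `head θ x = d` into the fixed point equation `x = θ⁻¹
  -- ^ 18 * d - P x`, where `P` is additive and contracts the ball of radius `r` by the factor `2 *
  -- r < 1`.
  let P : K → K := fun x => θ⁻¹ ^ 18 * (head θ x - θ ^ 18 * x)
  have hP : ∀ x, ‖x‖ ≤ r → ‖P x‖ ≤ 2 * r * ‖x‖ := by
    intro x hx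
    have hx1 : ‖x‖ ≤ 1 := by linarith
    have hle : ∀ n : ℕ, 2 ≤ n → ‖x‖ ^ n ≤ ‖x‖ ^ 2 := fun n hn =>
      pow_le_pow_of_le_one (norm_nonneg x) hx1 hn
    have h2 : ‖x‖ ^ 2 ≤ r * ‖x‖ := by
      rw [pow_two]
      exact mul_le_mul_of_nonneg_right hx (norm_nonneg x)
    have : ‖head θ x - θ ^ 18 * x‖ ≤ 2 ^ 19 * ‖x‖ ^ 2 := by
      rw [head, pow_one, add_sub_cancel_left]
      refine (IsUltrametricDist.norm_add_le_max _ _).trans (max_le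
        ((IsUltrametricDist.norm_add_le_max _ _).trans (max_le
          ((IsUltrametricDist.norm_add_le_max _ _).trans (max_le ?_ ?_)) ?_)) ?_) <;>
        rw [norm_theta_pow_mul_pow hθ]
      · linarith [hle 4 (by norm_num), sq_nonneg ‖x‖]
      · linarith [hle 8 (by norm_num), sq_nonneg ‖x‖]
      · linarith [hle 16 (by norm_num), sq_nonneg ‖x‖]
    rw [norm_mul, hθi]
    linarith
  have hPsub : ∀ x y, P (x - y) = P x - P y := fun x y => by
    simp only [P, head_sub]
    ring
  let g : K → K := fun x => θ⁻¹ ^ 18 * d - P x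
  have hmaps : Set.MapsTo g (Metric.closedBall 0 r) (Metric.closedBall 0 r) := by
    intro x hx
    rw [mem_closedBall_zero_iff] at hx ⊢
    refine (norm_sub_le_max' _ _).trans (max_le ?_ ?_)
    · rw [norm_mul, hθi]
      linarith
    · refine (hP x hx).trans ?_
      nlinarith [norm_nonneg x]
  have hcontr : ContractingWith ⟨2 * r, by positivity⟩ (hmaps.restrict g _ _) := by
    constructor
    · change (2 * r : ℝ) < 1
      linarith
    · refine LipschitzWith.of_dist_le_mul fun x y => ?_
      have hx := mem_closedBall_zero_iff.1 x.2
      have hy := mem_closedBall_zero_iff.1 y.2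
      rw [Subtype.dist_eq, Subtype.dist_eq, dist_eq_norm, dist_eq_norm]
      change ‖g x - g y‖ ≤ 2 * r * ‖(x : K) - y‖
      have : g x - g y = -P (x - y) := by
        rw [hPsub]
        simp only [g]
        ring
      rw [this, norm_neg]
      exact hP _ ((norm_sub_le_max' _ _).trans (max_le hx hy))
  obtain ⟨x, hx, hfix, -⟩ := ContractingWith.exists_fixedPoint'
    Metric.isClosed_closedBall.isComplete hmaps hcontr (x := 0)
    (Metric.mem_closedBall_self hr0.le) (edist_ne_top _ _)
  refine ⟨x, ?_, (mem_closedBall_zero_iff.1 hx).trans_lt hr⟩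
  have h : θ⁻¹ ^ 18 * d - θ⁻¹ ^ 18 * (head θ x - θ ^ 18 * x) = x := hfix
  field_simp at h
  linear_combination -h

theorem head_injective_of_lt (hθ : ‖θ‖ = 2) {x y : K} (hx : ‖x‖ < 1 / 2) (hy : ‖y‖ < 1 / 2)
    (h : head θ x = head θ y) : x = y := by
  have hxy : ‖x - y‖ < 1 / 2 :=
    (norm_sub_le_max' _ _).trans_lt (max_lt hx hy)
  have := norm_head_of_lt hθ hxy
  rw [head_sub, h, sub_self, norm_zero] at this
  rw [← sub_eq_zero, ← norm_eq_zero]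
  linarith

/-- The head has a root of absolute value `1 / 2`. -/
theorem exists_head_eq_zero [CompleteSpace K] (hθ : ‖θ‖ = 2) : ∃ x, head θ x = 0 ∧ ‖x‖ = 1 / 2 := by
  have h0 := ne_zero_of_norm_eq_two hθ
  have h2 : (2 : K) = 0 := CharTwo.two_eq_zero
  -- At `θ⁻¹` the terms of degrees 1 and 2 cancel in characteristic 2, and so do those of degrees 4
  -- and 8. The remaining error is small enough to be removed by an element of the disc `‖x‖ < 1/2`.
  have h1 : head θ θ⁻¹ = θ⁻¹ ^ 4 := by
    have : head θ θ⁻¹ = θ⁻¹ ^ 4 + 2 * (1 + θ ^ 17) := by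
      simp only [head]
      field_simp
      ring
    rw [this, h2, zero_mul, add_zero]
  obtain ⟨x, hx, hx'⟩ := exists_head_eq hθ (d := -θ⁻¹ ^ 4) (by
    rw [norm_neg, norm_pow, norm_inv_theta hθ]
    norm_num)
  refine ⟨θ⁻¹ + x, ?_, ?_⟩
  · rw [head_add, h1, hx, add_neg_cancel]
  · rw [norm_add_eq_left_of_lt, norm_inv_theta hθ]
    rwa [norm_inv_theta hθ]

/-- The first two terms of `head` factor as `θ ^ 19 * x * (x - θ⁻¹)` in characteristic 2, and the
other three are small at norm `1/2`. Thus all roots of norm `1/2` lie in one translate of the disc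
on which `head` is injective. -/
theorem norm_sub_inv_theta_lt (hθ : ‖θ‖ = 2) {x : K} (h : head θ x = 0) (hx : ‖x‖ = 1 / 2) :
    ‖x - θ⁻¹‖ < 1 / 2 := by
  have h0 := ne_zero_of_norm_eq_two hθ
  have h2 : (2 : K) = 0 := CharTwo.two_eq_zero
  have key : θ ^ 19 * x * (x - θ⁻¹) =
      -(θ ^ 4 * x ^ 4 + θ ^ 8 * x ^ 8 + θ ^ 12 * x ^ 16) := by
    simp only [head] at h
    have h1 : θ ^ 19 * x * (x - θ⁻¹) = θ ^ 19 * x ^ 2 - θ ^ 18 * x := by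
      field_simp
    rw [h1]
    linear_combination h - θ ^ 18 * x * h2
  have hlt : ‖θ ^ 4 * x ^ 4 + θ ^ 8 * x ^ 8 + θ ^ 12 * x ^ 16‖ < 2 := by
    refine norm_add_lt_of_lt (norm_add_lt_of_lt ?_ ?_) ?_ <;>
      rw [norm_theta_pow_mul_pow hθ, hx] <;> norm_num
  rw [← norm_neg, ← key, norm_mul, norm_mul, norm_pow, hθ, hx] at hlt
  linarith

/-- The head has only one root of absolute value `1 / 2`. -/
theorem head_root_unique (hθ : ‖θ‖ = 2) {x y : K} (hx : head θ x = 0) (hy : head θ y = 0)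
    (hx' : ‖x‖ = 1 / 2) (hy' : ‖y‖ = 1 / 2) : x = y := by
  refine sub_left_injective (head_injective_of_lt hθ (norm_sub_inv_theta_lt hθ hx hx')
    (norm_sub_inv_theta_lt hθ hy hy') ?_)
  rw [head_sub, head_sub, hx, hy]

end Newton

/-! ### Chains: existence, norms and minimality. -/

section Chains

variable {K : Type} [NormedField K] {θ : K}

/-- The left hand side of the `i`-th affine equation, multiplied by `θ ^ 24`. -/
def equationAt (θ : K) (x : ℕ → K) (i : ℕ) : K :=
  head θ (x i) + (tailOne θ (if 1 ≤ i then x (i - 1) else 0) +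
    (if 2 ≤ i then x (i - 2) else 0) ^ 16)

@[simp]
theorem tailOne_zero : tailOne θ 0 = 0 := by
  simp [tailOne]

theorem equationAt_zero (x : ℕ → K) : equationAt θ x 0 = head θ (x 0) := by
  simp [equationAt]

theorem equationAt_one (x : ℕ → K) : equationAt θ x 1 = head θ (x 1) + tailOne θ (x 0) := by
  simp [equationAt]

theorem equationAt_add_two (x : ℕ → K) (n : ℕ) :
    equationAt θ x (n + 2) = head θ (x (n + 2)) + (tailOne θ (x (n + 1)) + x n ^ 16) := by
  simp [equationAt]

/-- Only the head involves `x_i`, so changing `x_i` alone changes the equation by a difference of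
heads. -/
theorem equationAt_update (x : ℕ → K) (i : ℕ) (z : K) :
    equationAt θ (Function.update x i z) i = equationAt θ x i + (head θ z - head θ (x i)) := by
  rcases i with _ | _ | n
  · simp [equationAt_zero]
  · simp only [equationAt_one, zero_add, Function.update_self,
      Function.update_of_ne (zero_ne_one (α := ℕ))]
    ring
  · simp only [equationAt_add_two, Function.update_self, Function.update_of_ne
      (show n + 1 ≠ n + 1 + 1 by omega), Function.update_of_ne (show n ≠ n + 1 + 1 by omega)]
    ring

/-- A solution of the affine equation whose first term has absolute value `1 / 2`, all of whose
other terms are smaller. -/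
structure IsChain (θ : K) (x : ℕ → K) : Prop where
  equationAt_eq_zero : ∀ i, equationAt θ x i = 0
  norm_zero : ‖x 0‖ = 1 / 2
  norm_lt : ∀ i, 0 < i → ‖x i‖ < 1 / 2

/-- Consecutive terms of a chain. -/
def ChainPair (p : K × K) : Prop := p.2 ≠ 0 ∧ ‖p.2‖ ≤ 1 / 2 ∧ ‖p.1‖ ^ 4 ≤ ‖p.2‖

/-- The fictitious predecessor `0` lets the equation for `x_1` be handled like the later ones; this
is why `ChainPair` asks for an inequality and not for `‖p.2‖ = ‖p.1‖ ^ 4`. -/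
theorem chainPair_zero {x : K} (hx : ‖x‖ = 1 / 2) : ChainPair (0, x) := by
  refine ⟨?_, hx.le, by simp⟩
  rw [← norm_pos_iff, hx]
  norm_num

variable [IsUltrametricDist K]

theorem norm_tail_of_le (hθ : ‖θ‖ = 2) {y z : K} (hy : y ≠ 0) (hy' : ‖y‖ ≤ 1 / 2)
    (hz : ‖z‖ ^ 4 ≤ ‖y‖) : ‖tailOne θ y + z ^ 16‖ = 2 ^ 18 * ‖y‖ ^ 4 := by
  have hpos : 0 < ‖y‖ := norm_pos_iff.2 hy
  refine norm_tail hθ hy (by nlinarith) ?_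
  have : ‖z‖ ^ 16 ≤ ‖y‖ ^ 4 := by
    rw [show ‖z‖ ^ 16 = (‖z‖ ^ 4) ^ 4 by ring]
    exact pow_le_pow_left₀ (by positivity) hz 4
  have : 0 < ‖y‖ ^ 4 := by positivity
  linarith

/-- Head and tail have norms `2 ^ 18 * ‖x‖` and `2 ^ 18 * ‖y‖ ^ 4`; the factor cancels. -/
theorem norm_eq_pow_of_head_add_tail (hθ : ‖θ‖ = 2) {x y z : K} (hy : y ≠ 0) (hy' : ‖y‖ ≤ 1 / 2)
    (hz : ‖z‖ ^ 4 ≤ ‖y‖) (hx : ‖x‖ < 1 / 2)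
    (h : head θ x + (tailOne θ y + z ^ 16) = 0) : ‖x‖ = ‖y‖ ^ 4 := by
  have h1 := norm_head_of_lt hθ hx
  rw [eq_neg_of_add_eq_zero_left h, norm_neg, norm_tail_of_le hθ hy hy' hz] at h1
  linarith

theorem ChainPair.next (hθ : ‖θ‖ = 2) {p : K × K} (hp : ChainPair p) {x : K}
    (h : head θ x + (tailOne θ p.2 + p.1 ^ 16) = 0) (hx : ‖x‖ < 1 / 2) : ChainPair (p.2, x) := by
  have hn := norm_eq_pow_of_head_add_tail hθ hp.1 hp.2.1 hp.2.2 hx h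
  refine ⟨?_, hx.le, hn.ge⟩
  have : 0 < ‖p.2‖ := norm_pos_iff.2 hp.1
  rw [← norm_pos_iff, hn]
  positivity

theorem IsChain.norm_eq (hθ : ‖θ‖ = 2) {x : ℕ → K} (hx : IsChain θ x) (n : ℕ) :
    ‖x n‖ = (1 / 2) ^ 4 ^ n := by
  have key : ∀ n, ‖x (n + 1)‖ = ‖x n‖ ^ 4 ∧ ChainPair (x n, x (n + 1)) := by
    intro i
    induction i with
    | zero =>
      have hp := chainPair_zero hx.norm_zero
      have h : head θ (x (0 + 1)) + (tailOne θ (x 0) + 0 ^ 16) = 0 := by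
        simpa [equationAt_one] using hx.equationAt_eq_zero 1
      exact ⟨norm_eq_pow_of_head_add_tail hθ hp.1 hp.2.1 hp.2.2 (hx.norm_lt 1 one_pos) h,
        hp.next hθ h (hx.norm_lt 1 one_pos)⟩
    | succ n ih =>
      have hp := ih.2
      have h := hx.equationAt_eq_zero (n + 2)
      rw [equationAt_add_two] at h
      exact ⟨norm_eq_pow_of_head_add_tail hθ hp.1 hp.2.1 hp.2.2 (hx.norm_lt _ (by omega)) h,
        hp.next hθ h (hx.norm_lt _ (by omega))⟩
  induction n with
  | zero => simpa using hx.norm_zero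
  | succ n ih => rw [(key n).1, ih, ← pow_mul, pow_succ 4]

/-- The norm `√2` propagates: if `‖y‖ = √2`, the tail has norm `2 ^ 18 * 4 = 2 ^ 20`, and `head`
takes this norm only at norm `√2`. Hence no such solution tends to zero. -/
theorem norm_sq_eq_two (hθ : ‖θ‖ = 2) {x : ℕ → K} (hx : ∀ i, equationAt θ x i = 0)
    (h0 : 1 / 2 < ‖x 0‖) (n : ℕ) : ‖x n‖ ^ 2 = 2 := by
  have hstep : ∀ x y z : K, ‖y‖ ^ 2 = 2 → ‖z‖ ^ 2 ≤ 2 →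
      head θ x + (tailOne θ y + z ^ 16) = 0 → ‖x‖ ^ 2 = 2 := by
    intro x y z hy hz h
    have hy4 : ‖y‖ ^ 4 = 4 := by
      rw [show ‖y‖ ^ 4 = (‖y‖ ^ 2) ^ 2 by ring, hy]
      norm_num
    have hy0 : y ≠ 0 := by
      rintro rfl
      simp at hy
    have hz16 : ‖z‖ ^ 16 ≤ 256 := by
      rw [show ‖z‖ ^ 16 = (‖z‖ ^ 2) ^ 8 by ring]
      exact (pow_le_pow_left₀ (by positivity) hz 8).trans_eq (by norm_num)
    apply norm_sq_of_norm_head_eq hθ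
    rw [eq_neg_of_add_eq_zero_left h, norm_neg, norm_tail hθ hy0 hy.le (by
      rw [hy4]
      norm_num
      linarith), hy4]
    norm_num
  have hx0 : ‖x 0‖ ^ 2 = 2 := norm_sq_of_head_eq_zero hθ (by rw [← equationAt_zero, hx]) h0
  have key : ∀ n, ‖x n‖ ^ 2 = 2 ∧ ‖x (n + 1)‖ ^ 2 = 2 := by
    intro n
    induction n with
    | zero =>
      refine ⟨hx0, hstep _ _ 0 hx0 (by simp) ?_⟩
      have := hx 1
      simpa [equationAt_one] using this
    | succ n ih =>
      exact ⟨ih.2, hstep _ _ _ ih.2 ih.1.le ((equationAt_add_two x n).symm.trans (hx _))⟩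
  exact (key n).1

variable [CharP K 2]

theorem exists_next [CompleteSpace K] (hθ : ‖θ‖ = 2) {y z : K} (hy : y ≠ 0) (hy' : ‖y‖ ≤ 1 / 2)
    (hz : ‖z‖ ^ 4 ≤ ‖y‖) : ∃ x, head θ x + (tailOne θ y + z ^ 16) = 0 ∧ ‖x‖ < 1 / 2 := by
  obtain ⟨x, hx, hx'⟩ := exists_head_eq hθ (d := -(tailOne θ y + z ^ 16)) (by
    rw [norm_neg, norm_tail_of_le hθ hy hy' hz]
    have : ‖y‖ ^ 4 ≤ (1 / 2) ^ 4 := pow_le_pow_left₀ (norm_nonneg y) hy' 4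
    norm_num at this ⊢
    linarith)
  exact ⟨x, by rw [hx, neg_add_cancel], hx'⟩

theorem exists_isChain [CompleteSpace K] (hθ : ‖θ‖ = 2) : ∃ x, IsChain θ x := by
  obtain ⟨x₀, h0, hx₀⟩ := exists_head_eq_zero hθ
  have hex : ∀ p : {p : K × K // ChainPair p},
      ∃ x, head θ x + (tailOne θ p.1.2 + p.1.1 ^ 16) = 0 ∧ ‖x‖ < 1 / 2 :=
    fun p => exists_next hθ p.2.1 p.2.2.1 p.2.2.2
  choose next hnext hlt using hex
  -- The recursion has order two, so its state is a pair of consecutive terms together with the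
  -- invariant that makes the next step possible.
  let s : ℕ → {p : K × K // ChainPair p} := fun n =>
    Nat.rec ⟨(0, x₀), chainPair_zero hx₀⟩
      (fun _ p => ⟨(p.1.2, next p), p.2.next hθ (hnext p) (hlt p)⟩) n
  refine ⟨fun n => (s n).1.2, ?_, hx₀, ?_⟩
  · rintro (_ | _ | n)
    · rw [equationAt_zero]
      exact h0
    · rw [equationAt_one]
      have := hnext (s 0)
      rw [show (s 0).1.1 = 0 from rfl, zero_pow (by norm_num), add_zero] at this
      exact this
    · rw [equationAt_add_two]
      exact hnext (s (n + 1))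
  · rintro (_ | n) hi
    · exact absurd hi (lt_irrefl 0)
    · exact hlt (s n)

/-- A strictly smaller competitor would lie in the disc `‖x‖ < 1/2`, where `head` is injective, and
so would equal `x i`. -/
theorem IsChain.norm_le (hθ : ‖θ‖ = 2) {x : ℕ → K} (hx : IsChain θ x) {i : ℕ} (hi : 0 < i) {z : K}
    (hz : equationAt θ (Function.update x i z) i = 0) : ‖x i‖ ≤ ‖z‖ := by
  by_contra! h
  rw [equationAt_update, hx.equationAt_eq_zero, zero_add, sub_eq_zero] at hz
  rw [head_injective_of_lt hθ (h.trans (hx.norm_lt i hi)) (hx.norm_lt i hi) hz] at h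
  exact lt_irrefl _ h

/-- Converse of `IsChain.norm_le`: each equation has a solution in the disc `‖x‖ < 1/2`, and a term
of least norm is no larger. -/
theorem isChain_of_norm_le [CompleteSpace K] (hθ : ‖θ‖ = 2) {x : ℕ → K}
    (hx : ∀ i, equationAt θ x i = 0) (h0 : ‖x 0‖ = 1 / 2)
    (hmin : ∀ i, 0 < i → ∀ z, equationAt θ (Function.update x i z) i = 0 → ‖x i‖ ≤ ‖z‖) :
    IsChain θ x := by
  have hstep : ∀ i y z, equationAt θ x (i + 1) = head θ (x (i + 1)) + (tailOne θ y + z ^ 16) →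
      ChainPair (z, y) → ‖x (i + 1)‖ < 1 / 2 ∧ ChainPair (y, x (i + 1)) := by
    intro i y z h hp
    obtain ⟨w, hw, hlt⟩ := exists_next hθ hp.1 hp.2.1 hp.2.2
    have hle := hmin (i + 1) i.succ_pos w (by
      rw [equationAt_update, h, ← hw]
      ring)
    rw [hx] at h
    exact ⟨hle.trans_lt hlt, hp.next hθ h.symm (hle.trans_lt hlt)⟩
  have key : ∀ i, ‖x (i + 1)‖ < 1 / 2 ∧ ChainPair (x i, x (i + 1)) := by
    intro i
    induction i with
    | zero => exact hstep 0 (x 0) 0 (by simp [equationAt_one]) (chainPair_zero h0)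
    | succ n ih => exact hstep (n + 1) (x (n + 1)) (x n) (equationAt_add_two x n) ih.2
  refine ⟨hx, h0, ?_⟩
  rintro (_ | n) hi
  · exact absurd hi (lt_irrefl 0)
  · exact (key n).1

/-- Once all earlier terms vanish, `x n` is a root of `head` in its disc of injectivity. -/
theorem eq_zero_of_norm_lt (hθ : ‖θ‖ = 2) {x : ℕ → K} (hx : ∀ i, equationAt θ x i = 0)
    (hlt : ∀ n, ‖x n‖ < 1 / 2) (n : ℕ) : x n = 0 := by
  induction n using Nat.strong_induction_on with
  | _ n ih =>
    refine head_injective_of_lt hθ (hlt n) (by simp) ?_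
    have h := hx n
    rw [head_zero]
    rcases n with _ | _ | n
    · rwa [equationAt_zero] at h
    · rwa [equationAt_one, ih 0 (by omega), tailOne_zero, add_zero] at h
    · rwa [equationAt_add_two, ih n (by omega), ih (n + 1) (by omega), tailOne_zero,
        zero_pow (by norm_num), add_zero, add_zero] at h

end Chains

/-! ### The affine equation as an `𝔽_2[T]`-linear operator on power series. -/

section EquationOperator

variable {K : Type} [NormedField K] [CharP K 2] {θ : K}

open PowerSeries in
/-- The operator on power series whose `i`-th coefficient is the `i`-th affine equation. -/
def equationOp (θ : K) (f : K⟦X⟧) : K⟦X⟧ :=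
  let φ : K⟦X⟧ →+* K⟦X⟧ := PowerSeries.map (frobenius K 2)
  let t : K⟦X⟧ := PowerSeries.C θ
  t ^ 18 * f + t ^ 19 * φ f + t ^ 4 * φ (φ f) + t ^ 8 * φ (φ (φ f)) + t ^ 12 * φ (φ (φ (φ f))) -
    X * ((t ^ 18 + 1) * φ (φ f) + t ^ 4 * φ (φ (φ f)) + (t ^ 8 + t ^ 4) * φ (φ (φ (φ f)))) +
    X * (X * φ (φ (φ (φ f))))

theorem coeff_equationOp (f : K⟦X⟧) (i : ℕ) :
    PowerSeries.coeff i (equationOp θ f) = equationAt θ (fun j => PowerSeries.coeff j f) i := by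
  have hC : ∀ (n : ℕ) (g : K⟦X⟧) (j : ℕ), PowerSeries.coeff j ((PowerSeries.C θ) ^ n * g) =
      θ ^ n * PowerSeries.coeff j g := fun n g j => by
    rw [← map_pow, PowerSeries.coeff_C_mul]
  simp only [equationOp, map_add, map_sub, hC, add_mul, one_mul, PowerSeries.coeff_map,
    frobenius_def, ← pow_mul]
  rcases i with _ | _ | n
  · simp [equationAt_zero, head]
    ring
  · rw [equationAt_one, PowerSeries.coeff_succ_X_mul,
      PowerSeries.coeff_succ_X_mul]
    simp only [head, tailOne, hC, zero_add, PowerSeries.coeff_zero_X_mul, PowerSeries.coeff_map,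
      map_add, frobenius_def, ← pow_mul]
    ring
  · rw [equationAt_add_two, PowerSeries.coeff_succ_X_mul, PowerSeries.coeff_succ_X_mul,
      PowerSeries.coeff_succ_X_mul]
    simp only [head, tailOne, hC, map_add, PowerSeries.coeff_map, frobenius_def, ← pow_mul]
    ring

theorem equationOp_eq_zero_iff {f : K⟦X⟧} :
    equationOp θ f = 0 ↔ ∀ i, equationAt θ (fun j => PowerSeries.coeff j f) i = 0 := by
  simp only [PowerSeries.ext_iff, coeff_equationOp, map_zero]

theorem equationOp_sub (f g : K⟦X⟧) : equationOp θ (f - g) = equationOp θ f - equationOp θ g := by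
  simp only [equationOp, map_sub]
  ring

/-- The operator is a combination of powers of Frobenius, hence linear over Frobenius-invariant
series. This gives both linearity over `𝔽_2[T]` and the possibility of dividing a solution by `T`.
-/
theorem equationOp_mul {a : K⟦X⟧} (ha : PowerSeries.map (frobenius K 2) a = a) (f : K⟦X⟧) :
    equationOp θ (a * f) = a * equationOp θ f := by
  simp only [equationOp, map_mul, ha]
  ring

variable [Algebra (ZMod 2) K]

theorem equationOp_smul (p : (ZMod 2)[X]) (f : K⟦X⟧) :
    equationOp θ (p • f) = p • equationOp θ f := by
  rw [Algebra.smul_def, Algebra.smul_def, equationOp_mul]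
  ext i
  rw [PowerSeries.coeff_map, PowerSeries.algebraMap_apply', PowerSeries.coeff_map, frobenius_def,
    ← map_pow, ZMod.pow_card]

/-- The solutions of the affine equation whose coefficients are eventually less than `1 / 2` in
absolute value are the multiples of a chain. -/
theorem IsChain.exists_smul_eq [IsUltrametricDist K] (hθ : ‖θ‖ = 2) {x : K⟦X⟧}
    (hx : IsChain θ fun j => PowerSeries.coeff j x) (N : ℕ) {f : K⟦X⟧} (hf : equationOp θ f = 0)
    (hN : ∀ n, N ≤ n → ‖PowerSeries.coeff n f‖ < 1 / 2) : ∃ p : (ZMod 2)[X], p • x = f := by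
  have hxop : equationOp θ x = 0 := equationOp_eq_zero_iff.2 hx.equationAt_eq_zero
  induction N generalizing f with
  | zero =>
    refine ⟨0, ?_⟩
    rw [zero_smul]
    ext n
    exact (eq_zero_of_norm_lt hθ (equationOp_eq_zero_iff.1 hf) (fun n => hN n n.zero_le) n).symm
  | succ N ih =>
    -- Once `c • x` matches the constant term of `f`, the quotient `(f - c • x) / T` is again a
    -- solution, with threshold `N` instead of `N + 1`. Only `c = 0` and `c = 1` are needed.
    have hstep : ∀ c : (ZMod 2)[X], PowerSeries.coeff 0 (c • x) = PowerSeries.coeff 0 f →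
        (∀ n, 0 < n → ‖PowerSeries.coeff n (c • x)‖ < 1 / 2) → ∃ p : (ZMod 2)[X], p • x = f := by
      intro c hc hlt
      obtain ⟨g, hg⟩ := (PowerSeries.X_dvd_iff (φ := f - c • x)).2 (by
        rw [← PowerSeries.coeff_zero_eq_constantCoeff_apply, map_sub, hc, sub_self])
      have hgop : equationOp θ g = 0 := by
        have h := equationOp_mul (θ := θ) (PowerSeries.map_X (frobenius K 2)) g
        rw [← hg, equationOp_sub, hf, equationOp_smul, hxop, smul_zero, sub_zero] at h
        exact (mul_eq_zero.1 h.symm).resolve_left PowerSeries.X_ne_zero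
      obtain ⟨p, hp⟩ := ih hgop fun n hn => by
        rw [← PowerSeries.coeff_succ_X_mul, ← hg, map_sub]
        exact (norm_sub_le_max' _ _).trans_lt (max_lt (hN _ (by omega)) (hlt _ n.succ_pos))
      refine ⟨c + Polynomial.X * p, ?_⟩
      rw [add_smul, mul_smul, hp, Algebra.smul_def Polynomial.X,
        PowerSeries.algebraMap_apply', Polynomial.coe_X, PowerSeries.map_X, ← hg,
        add_sub_cancel]
    have hroot : head θ (PowerSeries.coeff 0 f) = 0 := by
      have := equationOp_eq_zero_iff.1 hf 0
      rwa [equationAt_zero] at this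
    rcases lt_trichotomy ‖PowerSeries.coeff 0 f‖ (1 / 2) with hlt | heq | hgt
    · refine hstep 0 ?_ fun n _ => by simp
      rw [zero_smul, map_zero]
      exact (head_injective_of_lt hθ hlt (by simp) (by rw [hroot, head_zero])).symm
    · refine hstep 1 ?_ fun n hn => by simpa using hx.norm_lt n hn
      rw [one_smul]
      have hroot' := hx.equationAt_eq_zero 0
      rw [equationAt_zero] at hroot'
      exact head_root_unique hθ hroot' hroot hx.norm_zero heq
    -- A larger constant term forces norm `√2` in every degree, against the bound in degree `N + 1`.
    · have h1 := norm_sq_eq_two hθ (equationOp_eq_zero_iff.1 hf) hgt (N + 1)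
      have h2 := hN (N + 1) le_rfl
      nlinarith [norm_nonneg (PowerSeries.coeff (N + 1) f)]

end EquationOperator

/-! ### Freeness of the t-motive over `C_∞[T]`, and `τ` in coordinates. -/

section Twist

variable {F : Type} [Field F] [Fintype F] {n : ℕ} (A N : Matrix (Fin n) (Fin n) (CInfty F))

/-- The matrix `θ + N`. -/
def constMatrix : Matrix (Fin n) (Fin n) (CInfty F) :=
  theta F • (1 : Matrix (Fin n) (Fin n) (CInfty F)) + N

/-- The action of `τ` on `M(A, N) ⊗ R` in the coordinates given by the basis
`e_1, …, e_n, τ e_1, …, τ e_n`, where `t` is the action of `τ` on `R`. -/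
def twist {R : Type} [AddCommGroup R] [Module (CInfty F)[X] R] (t : R →ₛₗ[polyFrob F] R) :
    (Fin n ⊕ Fin n → R) →ₛₗ[polyFrob F] (Fin n ⊕ Fin n → R) where
  toFun w := Sum.elim
    (fun j => (Polynomial.X : (CInfty F)[X]) • t (w (.inr j)) -
      ∑ i, (Polynomial.C (constMatrix N i j) : (CInfty F)[X]) • t (w (.inr i)))
    (fun j => t (w (.inl j)) - ∑ i, (Polynomial.C (A i j) : (CInfty F)[X]) • t (w (.inr i)))
  map_add' v w := by
    ext (j | j) <;> simp only [Pi.add_apply, Sum.elim_inl, Sum.elim_inr, map_add, smul_add,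
      Finset.sum_add_distrib] <;> abel
  map_smul' p w := by
    ext (j | j) <;> simp only [Pi.smul_apply, Sum.elim_inl, Sum.elim_inr, LinearMap.map_smulₛₗ,
      smul_sub, Finset.smul_sum, smul_comm (polyFrob F p)]

theorem twist_inl {R : Type} [AddCommGroup R] [Module (CInfty F)[X] R] (t : R →ₛₗ[polyFrob F] R)
    (w : Fin n ⊕ Fin n → R) (j : Fin n) : twist A N t w (.inl j) =
      (Polynomial.X : (CInfty F)[X]) • t (w (.inr j)) -
        ∑ i, (Polynomial.C (constMatrix N i j) : (CInfty F)[X]) • t (w (.inr i)) := rfl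

theorem twist_inr {R : Type} [AddCommGroup R] [Module (CInfty F)[X] R] (t : R →ₛₗ[polyFrob F] R)
    (w : Fin n ⊕ Fin n → R) (j : Fin n) : twist A N t w (.inr j) =
      t (w (.inl j)) - ∑ i, (Polynomial.C (A i j) : (CInfty F)[X]) • t (w (.inr i)) := rfl

/-- The action of `τ` on `C_∞[T]`. -/
def polyTau : (CInfty F)[X] →ₛₗ[polyFrob F] (CInfty F)[X] where
  toFun := polyFrob F
  map_add' := map_add _
  map_smul' p q := by simp only [smul_eq_mul, map_mul]

theorem polyTau_apply (p : (CInfty F)[X]) : polyTau p = polyFrob F p := rfl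

theorem polyTau_single (i j : Fin n ⊕ Fin n) :
    polyTau (Pi.single (M := fun _ => (CInfty F)[X]) i 1 j) =
      Pi.single (M := fun _ => (CInfty F)[X]) i 1 j := by
  rw [Pi.single_apply, polyTau_apply]
  split_ifs <;> simp

/-- The coordinates of `e_j`. -/
def baseVec (i : Fin n ⊕ Fin n) : Fin n ⊕ Fin n → (CInfty F)[X] := Pi.single i 1

theorem twist_baseVec_inl (j : Fin n) :
    twist A N polyTau (baseVec (.inl j)) = baseVec (.inr j) := by
  ext1 (i | i)
  · simp only [baseVec, twist_inl, polyTau_single]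
    simp
  · simp only [baseVec, twist_inr, polyTau_single]
    simp [Pi.single_apply]

theorem twist_baseVec_inr (i : Fin n) :
    twist A N polyTau (baseVec (.inr i)) = (Polynomial.X : (CInfty F)[X]) • baseVec (.inl i) -
      ∑ j, (Polynomial.C (constMatrix N i j) : (CInfty F)[X]) • baseVec (.inl j) -
      ∑ j, (Polynomial.C (A i j) : (CInfty F)[X]) • baseVec (.inr j) := by
  ext1 (j | j)
  · simp only [baseVec, twist_inl, polyTau_single]
    simp [Pi.single_apply, Finset.sum_apply]
  · simp only [baseVec, twist_inr, polyTau_single]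
    simp [Pi.single_apply, Finset.sum_apply]

theorem polyFrob_C (a : CInfty F) : polyFrob F (Polynomial.C a) = Polynomial.C (frob F a) :=
  Polynomial.map_C _

theorem polyFrob_X : polyFrob F Polynomial.X = Polynomial.X :=
  Polynomial.map_X _

/-- The action of `τ` on coordinate vectors, as an additive endomorphism. -/
def coordTau : AddMonoid.End (Fin n ⊕ Fin n → (CInfty F)[X]) :=
  (twist A N polyTau).toAddMonoidHom

theorem coordTau_pow_succ (k : ℕ) (w : Fin n ⊕ Fin n → (CInfty F)[X]) :
    (coordTau A N ^ (k + 1)) w = twist A N polyTau ((coordTau A N ^ k) w) := by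
  rw [pow_succ']
  rfl

theorem coordTau_pow_smul (k : ℕ) (a : CInfty F) (w : Fin n ⊕ Fin n → (CInfty F)[X]) :
    (coordTau A N ^ k) ((Polynomial.C a : (CInfty F)[X]) • w) =
      (Polynomial.C ((frob F ^ k) a) : (CInfty F)[X]) • (coordTau A N ^ k) w := by
  induction k with
  | zero => rfl
  | succ k ih =>
    rw [coordTau_pow_succ, coordTau_pow_succ, ih, pow_succ', LinearMap.map_smulₛₗ,
      polyFrob_C]
    rfl

theorem coordTau_pow_X_smul (k : ℕ) (w : Fin n ⊕ Fin n → (CInfty F)[X]) :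
    (coordTau A N ^ k) ((Polynomial.X : (CInfty F)[X]) • w) =
      (Polynomial.X : (CInfty F)[X]) • (coordTau A N ^ k) w := by
  induction k with
  | zero => rfl
  | succ k ih =>
    rw [coordTau_pow_succ, coordTau_pow_succ, ih, LinearMap.map_smulₛₗ, polyFrob_X]

/-- The action of `C_∞{τ}` on coordinate vectors. -/
def coordEval : TwistedPolynomial F →+* AddMonoid.End (Fin n ⊕ Fin n → (CInfty F)[X]) :=
  SkewMonoidAlgebra.liftNCRingHom
    ((Module.toAddMonoidEnd (CInfty F)[X] (Fin n ⊕ Fin n → (CInfty F)[X])).comp Polynomial.C)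
    (powersHom (AddMonoid.End (Fin n ⊕ Fin n → (CInfty F)[X])) (coordTau A N)) (by
    intro a y
    ext1 w
    exact (coordTau_pow_smul A N (Multiplicative.toAdd y) a w).symm)

theorem coordEval_monomial (k : ℕ) (a : CInfty F) (w : Fin n ⊕ Fin n → (CInfty F)[X]) :
    coordEval A N (SkewPolynomial.monomial k a) w =
      (Polynomial.C a : (CInfty F)[X]) • (coordTau A N ^ k) w := by
  have h : coordEval A N (SkewPolynomial.monomial k a) = _ :=
    SkewMonoidAlgebra.liftNC_single _ _ (Multiplicative.ofAdd k) a
  rw [h]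
  rfl

theorem coordEval_add (r s : TwistedPolynomial F) (w : Fin n ⊕ Fin n → (CInfty F)[X]) :
    coordEval A N (r + s) w = coordEval A N r w + coordEval A N s w := by
  rw [map_add]
  rfl

theorem coordEval_mul (r s : TwistedPolynomial F) (w : Fin n ⊕ Fin n → (CInfty F)[X]) :
    coordEval A N (r * s) w = coordEval A N r (coordEval A N s w) := by
  rw [map_mul]
  rfl

theorem twistedPolynomial_induction {P : TwistedPolynomial F → Prop} (r : TwistedPolynomial F)
    (add : ∀ p q, P p → P q → P (p + q)) (monomial : ∀ k a, P (SkewPolynomial.monomial k a)) :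
    P r := by
  refine SkewPolynomial.induction r ?_ fun k a q _ _ hq => add _ _ (monomial k a) hq
  have := monomial 0 0
  rwa [SkewPolynomial.monomial_zero_right] at this

theorem coordEval_X_smul (r : TwistedPolynomial F) (w : Fin n ⊕ Fin n → (CInfty F)[X]) :
    coordEval A N r ((Polynomial.X : (CInfty F)[X]) • w) =
      (Polynomial.X : (CInfty F)[X]) • coordEval A N r w := by
  induction r using twistedPolynomial_induction with
  | add p q hp hq => rw [coordEval_add, coordEval_add, hp, hq, smul_add]
  | monomial k a => rw [coordEval_monomial, coordEval_monomial, coordTau_pow_X_smul, smul_comm]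

/-- The coordinates of an element of `M(A, N)`. -/
def coords (v : Fin n → TwistedPolynomial F) : Fin n ⊕ Fin n → (CInfty F)[X] :=
  ∑ j, coordEval A N (v j) (baseVec (.inl j))

theorem coords_add (v w : Fin n → TwistedPolynomial F) :
    coords A N (v + w) = coords A N v + coords A N w := by
  simp only [coords, Pi.add_apply, coordEval_add, Finset.sum_add_distrib]

theorem coords_smul (r : TwistedPolynomial F) (v : Fin n → TwistedPolynomial F) :
    coords A N (r • v) = coordEval A N r (coords A N v) := by
  simp only [coords, Pi.smul_apply, smul_eq_mul, coordEval_mul, map_sum]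

/-- The `τ ^ 2` part of the row contributes `T e_i - (θ + N) e_i - A τ e_i` in coordinates, which
cancels the other two parts up to `T e_i`. This makes the coordinate map linear in `T`. -/
theorem coords_actionMatrix (i : Fin n) :
    coords A N (actionMatrix A N i) = (Polynomial.X : (CInfty F)[X]) • baseVec (.inl i) := by
  have h1 : ∀ j : Fin n, (Polynomial.C ((1 : Matrix (Fin n) (Fin n) (CInfty F)) i j) :
      (CInfty F)[X]) • twist A N polyTau (baseVec (.inr j)) =
        if i = j then twist A N polyTau (baseVec (.inr j)) else 0 := by
    intro j
    rw [Matrix.one_apply]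
    split_ifs <;> simp
  have h0 : ∀ w : Fin n ⊕ Fin n → (CInfty F)[X], (coordTau A N ^ 0) w = w := fun _ => rfl
  have h : ∀ j, coordEval A N (actionMatrix A N i j) (baseVec (.inl j)) =
      (Polynomial.C (constMatrix N i j) : (CInfty F)[X]) • baseVec (.inl j) +
      (Polynomial.C (A i j) : (CInfty F)[X]) • baseVec (.inr j) +
      if i = j then twist A N polyTau (baseVec (.inr j)) else 0 := by
    intro j
    rw [actionMatrix, coordEval_add, coordEval_add, coordEval_monomial, coordEval_monomial,
      coordEval_monomial, coordTau_pow_succ, coordTau_pow_succ, coordTau_pow_succ, h0,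
      twist_baseVec_inl, h1]
    rfl
  rw [coords, Finset.sum_congr rfl fun j _ => h j, Finset.sum_add_distrib, Finset.sum_add_distrib,
    Finset.sum_ite_eq, if_pos (Finset.mem_univ i), twist_baseVec_inr]
  abel

theorem coords_vecMul (v : Fin n → TwistedPolynomial F) :
    coords A N (Matrix.vecMul v (actionMatrix A N)) =
      (Polynomial.X : (CInfty F)[X]) • coords A N v := by
  have h : Matrix.vecMul v (actionMatrix A N) = ∑ i, v i • actionMatrix A N i := by
    ext1 j
    simp [Matrix.vecMul, dotProduct, Finset.sum_apply]
  have hsum : ∀ f : Fin n → Fin n → TwistedPolynomial F,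
      coords A N (∑ i, f i) = ∑ i, coords A N (f i) :=
    fun f => map_sum (AddMonoidHom.mk' (coords A N) (coords_add A N)) f Finset.univ
  rw [h, hsum]
  simp only [coords_smul, coords_actionMatrix, coordEval_X_smul]
  rw [← Finset.smul_sum]
  rfl

/-! ### The coordinate isomorphism and its inverse. -/

section Module

/-- The row vector of an element of `M(A, N)`. -/
def vec (v : TMotive A N) : Fin n → TwistedPolynomial F := v

variable {A N}

theorem vec_C_smul (r : TwistedPolynomial F) (v : TMotive A N) :
    vec A N ((Polynomial.C r : AndersonRing F) • v) = r • vec A N v := by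
  have h : actionHom A N (Polynomial.C r) = _ := Polynomial.eval₂_C _ _
  exact congrArg (fun f : AddMonoid.End (Fin n → TwistedPolynomial F) => f (vec A N v)) h

theorem vec_X_smul (v : TMotive A N) :
    vec A N ((Polynomial.X : AndersonRing F) • v) =
      Matrix.vecMul (vec A N v) (actionMatrix A N) := by
  have h : actionHom A N Polynomial.X = _ := Polynomial.eval₂_X _ _
  exact congrArg (fun f : AddMonoid.End (Fin n → TwistedPolynomial F) => f (vec A N v)) h

theorem vec_add (v w : TMotive A N) : vec A N (v + w) = vec A N v + vec A N w := rfl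

theorem polyIncl_C (a : CInfty F) :
    polyIncl F (Polynomial.C a) = Polynomial.C (SkewPolynomial.monomial 0 a) := by
  rw [polyIncl, Polynomial.coe_mapRingHom, Polynomial.map_C]
  rfl

theorem polyIncl_X : polyIncl F Polynomial.X = Polynomial.X := by
  rw [polyIncl, Polynomial.coe_mapRingHom, Polynomial.map_X]

theorem coords_polyIncl_smul (p : (CInfty F)[X]) (v : TMotive A N) :
    coords A N (vec A N (polyIncl F p • v)) = p • coords A N (vec A N v) := by
  induction p using Polynomial.induction_on generalizing v with
  | C a =>
    rw [polyIncl_C, vec_C_smul, coords_smul, coordEval_monomial]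
    rfl
  | add p q hp hq => rw [map_add, add_smul, add_smul, vec_add, coords_add, hp, hq]
  | monomial k a ih =>
    rw [pow_succ, ← mul_assoc, map_mul, mul_smul, ih, polyIncl_X, vec_X_smul, coords_vecMul,
      smul_smul]

variable (A N)

/-- The coordinates on `M(A, N)`, as a map of `C_∞[T]`-modules. -/
def coordsLinear : Restr (TMotive A N) →ₗ[(CInfty F)[X]] (Fin n ⊕ Fin n → (CInfty F)[X]) where
  toFun v := coords A N (vec A N v)
  map_add' v w := coords_add A N (vec A N v) (vec A N w)
  map_smul' p v := coords_polyIncl_smul p v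

theorem coordsLinear_C_smul (r : TwistedPolynomial F) (v : Restr (TMotive A N)) :
    coordsLinear A N ((Polynomial.C r : AndersonRing F) • v) =
      coordEval A N r (coordsLinear A N v) :=
  (congrArg (coords A N) (vec_C_smul r v)).trans (coords_smul A N r _)

theorem coordsLinear_tau (v : Restr (TMotive A N)) :
    coordsLinear A N (moduleTau F _ v) = twist A N polyTau (coordsLinear A N v) := by
  refine (coordsLinear_C_smul A N SkewPolynomial.X v).trans ?_
  rw [SkewPolynomial.X, coordEval_monomial, map_one, one_smul, pow_one]
  rfl

/-- The basis element `e_j` of `M(A, N)`. -/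
def basisVec (j : Fin n) : Restr (TMotive A N) :=
  (Pi.single j 1 : Fin n → TwistedPolynomial F)

theorem coordsLinear_basisVec (j : Fin n) :
    coordsLinear A N (basisVec A N j) = baseVec (.inl j) := by
  change ∑ i, coordEval A N ((Pi.single j 1 : Fin n → TwistedPolynomial F) i) (baseVec (.inl i)) = _
  rw [Finset.sum_eq_single j]
  · rw [Pi.single_eq_same, map_one]
    rfl
  · intro i _ hij
    rw [Pi.single_eq_of_ne hij, map_zero]
    rfl
  · simp

/-- The element of `M(A, N)` with given coordinates. -/
def ofCoords : (Fin n ⊕ Fin n → (CInfty F)[X]) →ₗ[(CInfty F)[X]] Restr (TMotive A N) :=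
  (Pi.basisFun (CInfty F)[X] (Fin n ⊕ Fin n)).constr (CInfty F)[X]
    (Sum.elim (basisVec A N) fun j => moduleTau F _ (basisVec A N j))

theorem ofCoords_baseVec (i : Fin n ⊕ Fin n) : ofCoords A N (baseVec i) =
    Sum.elim (basisVec A N) (fun j => moduleTau F _ (basisVec A N j)) i := by
  rw [baseVec, ← Pi.basisFun_apply, ofCoords, Module.Basis.constr_basis]

theorem coordsLinear_ofCoords (w : Fin n ⊕ Fin n → (CInfty F)[X]) :
    coordsLinear A N (ofCoords A N w) = w := by
  have h : (coordsLinear A N).comp (ofCoords A N) = LinearMap.id := by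
    refine (Pi.basisFun (CInfty F)[X] (Fin n ⊕ Fin n)).ext fun i => ?_
    rw [Pi.basisFun_apply]
    change coordsLinear A N (ofCoords A N (baseVec i)) = baseVec i
    rw [ofCoords_baseVec]
    rcases i with j | j
    · exact coordsLinear_basisVec A N j
    · rw [Sum.elim_inr, coordsLinear_tau, coordsLinear_basisVec, twist_baseVec_inl]
  exact LinearMap.congr_fun h w

theorem vec_sum {ι : Type} (s : Finset ι) (v : ι → TMotive A N) :
    vec A N (∑ i ∈ s, v i) = ∑ i ∈ s, vec A N (v i) :=
  map_sum (AddMonoidHom.mk' (vec A N) vec_add) v s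

theorem vec_C_smul_basisVec (r : TwistedPolynomial F) (j : Fin n) :
    vec A N ((Polynomial.C r : AndersonRing F) • basisVec A N j : Restr (TMotive A N)) =
      Pi.single j r := by
  refine (vec_C_smul r _).trans ?_
  change r • (Pi.single j 1 : Fin n → TwistedPolynomial F) = _
  rw [← Pi.single_smul, smul_eq_mul, mul_one]

theorem sum_C_smul_basisVec (v : Restr (TMotive A N)) :
    ∑ j, (Polynomial.C (vec A N v j) : AndersonRing F) • basisVec A N j = v := by
  refine (vec_sum A N Finset.univ _).trans ?_
  rw [Finset.sum_congr rfl fun j _ => vec_C_smul_basisVec A N (vec A N v j) j]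
  exact Finset.univ_sum_single (vec A N v)

/-- The relation `τ ^ 2 e_* = T e_* - (θ + N) e_* - A τ e_*`. -/
theorem moduleTau_moduleTau_basisVec (i : Fin n) :
    moduleTau F _ (moduleTau F _ (basisVec A N i)) =
      (Polynomial.X : (CInfty F)[X]) • basisVec A N i -
        ∑ j, (Polynomial.C (constMatrix N i j) : (CInfty F)[X]) • basisVec A N j -
        ∑ j, (Polynomial.C (A i j) : (CInfty F)[X]) • moduleTau F _ (basisVec A N j) := by
  have h1 : ∀ a j, (Polynomial.C a : (CInfty F)[X]) • basisVec A N j =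
      (Polynomial.C (SkewPolynomial.monomial 0 a) : AndersonRing F) • basisVec A N j := by
    intro a j
    rw [← polyIncl_C]
    rfl
  have h2 : ∀ a j, (Polynomial.C a : (CInfty F)[X]) • moduleTau F _ (basisVec A N j) =
      (Polynomial.C (SkewPolynomial.monomial 1 a) : AndersonRing F) • basisVec A N j := by
    intro a j
    change polyIncl F (Polynomial.C a) • ((Polynomial.C SkewPolynomial.X : AndersonRing F) •
      basisVec A N j) = _
    rw [polyIncl_C, ← mul_smul, ← Polynomial.C_mul, SkewPolynomial.monomial_mul_X]
  have h3 : moduleTau F _ (moduleTau F _ (basisVec A N i)) =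
      (Polynomial.C (SkewPolynomial.monomial 2 1) : AndersonRing F) • basisVec A N i := by
    change (Polynomial.C SkewPolynomial.X : AndersonRing F) •
      ((Polynomial.C SkewPolynomial.X : AndersonRing F) • basisVec A N i) = _
    rw [← mul_smul, ← Polynomial.C_mul, ← pow_two, SkewPolynomial.monomial_one_right_eq_X_pow]
  have h4 : (Polynomial.X : (CInfty F)[X]) • basisVec A N i =
      ∑ j, (Polynomial.C (actionMatrix A N i j) : AndersonRing F) • basisVec A N j := by
    have h : vec A N ((Polynomial.X : (CInfty F)[X]) • basisVec A N i : Restr (TMotive A N)) =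
        actionMatrix A N i := by
      change vec A N (polyIncl F Polynomial.X • basisVec A N i : Restr (TMotive A N)) = _
      rw [polyIncl_X]
      exact (vec_X_smul (A := A) (N := N) _).trans (Matrix.single_one_vecMul i _)
    rw [← h, sum_C_smul_basisVec]
  have h5 : ∀ j, (Polynomial.C (SkewPolynomial.monomial 2
      ((1 : Matrix (Fin n) (Fin n) (CInfty F)) i j)) : AndersonRing F) • basisVec A N j =
        if i = j then (Polynomial.C (SkewPolynomial.monomial 2 1) : AndersonRing F) •
          basisVec A N j else 0 := by
    intro j
    rw [Matrix.one_apply]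
    split_ifs <;> simp
  simp only [h1, h2, h3, h4, actionMatrix, Polynomial.C_add, add_smul, Finset.sum_add_distrib, h5,
    Finset.sum_ite_eq, Finset.mem_univ, if_true]
  simp only [constMatrix]
  abel

/-- Both sides are semilinear, so the basis suffices; on `τ e_j` the claim is the relation for `τ ^
2 e_*`. It makes `ofCoords` commute with `C_∞{τ}`, hence a left inverse of the coordinates. -/
theorem ofCoords_twist (w : Fin n ⊕ Fin n → (CInfty F)[X]) :
    ofCoords A N (twist A N polyTau w) = moduleTau F _ (ofCoords A N w) := by
  have h : (ofCoords A N).comp (twist A N polyTau) = (moduleTau F _).comp (ofCoords A N) := by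
    refine (Pi.basisFun (CInfty F)[X] (Fin n ⊕ Fin n)).ext fun i => ?_
    rw [Pi.basisFun_apply]
    change ofCoords A N (twist A N polyTau (baseVec i)) =
      moduleTau F _ (ofCoords A N (baseVec i))
    rw [ofCoords_baseVec]
    rcases i with j | j
    · rw [twist_baseVec_inl, ofCoords_baseVec]
      rfl
    · simp only [twist_baseVec_inr, map_sub, map_smul, map_sum, ofCoords_baseVec, Sum.elim_inl,
        Sum.elim_inr, moduleTau_moduleTau_basisVec]
  exact LinearMap.congr_fun h w

theorem ofCoords_coordEval (r : TwistedPolynomial F) (w : Fin n ⊕ Fin n → (CInfty F)[X]) :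
    ofCoords A N (coordEval A N r w) = (Polynomial.C r : AndersonRing F) • ofCoords A N w := by
  induction r using twistedPolynomial_induction with
  | add p q hp hq => rw [coordEval_add, map_add, hp, hq, Polynomial.C_add, add_smul]
  | monomial k a =>
    have hk : ofCoords A N ((coordTau A N ^ k) w) =
        (Polynomial.C (SkewPolynomial.X ^ k) : AndersonRing F) • ofCoords A N w := by
      induction k with
      | zero => rw [pow_zero, pow_zero, Polynomial.C_1, one_smul]; rfl
      | succ k ih =>
        rw [coordTau_pow_succ, ofCoords_twist, ih, pow_succ', Polynomial.C_mul, mul_smul]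
        rfl
    rw [coordEval_monomial, map_smul, hk]
    change polyIncl F (Polynomial.C a) • ((Polynomial.C (SkewPolynomial.X ^ k) : AndersonRing F) •
      ofCoords A N w) = _
    rw [polyIncl_C, ← mul_smul, ← Polynomial.C_mul, SkewPolynomial.monomial_mul_X_pow, zero_add]

theorem ofCoords_coordsLinear (v : Restr (TMotive A N)) :
    ofCoords A N (coordsLinear A N v) = v := by
  change ofCoords A N (∑ j, coordEval A N (vec A N v j) (baseVec (.inl j))) = v
  rw [map_sum]
  simp only [ofCoords_coordEval, ofCoords_baseVec, Sum.elim_inl]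
  exact sum_C_smul_basisVec A N v

/-- The t-motive `M(A, N)` is free over `C_∞[T]` on `e_1, …, e_n, τ e_1, …, τ e_n`. -/
def coordsEquiv : Restr (TMotive A N) ≃ₗ[(CInfty F)[X]] (Fin n ⊕ Fin n → (CInfty F)[X]) :=
  { coordsLinear A N with
    invFun := ofCoords A N
    left_inv := ofCoords_coordsLinear A N
    right_inv := coordsLinear_ofCoords A N }

theorem coordsEquiv_tau (v : Restr (TMotive A N)) :
    coordsEquiv A N (moduleTau F _ v) = twist A N polyTau (coordsEquiv A N v) :=
  coordsLinear_tau A N v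

end Module

end Twist

/-! ### Coordinates after tensoring with `C_∞{T}`. -/

section TateCoordinates

variable {F : Type} [Field F] [Fintype F] {n : ℕ} (A N : Matrix (Fin n) (Fin n) (CInfty F))

/-- The coordinates on `M(A, N){T}`. -/
def tateCoords : TateModule F (TMotive A N) ≃ₗ[(CInfty F)[X]] (Fin n ⊕ Fin n → TateAlg F) :=
  (TensorProduct.equivFinsuppOfBasisLeft (Module.Basis.ofEquivFun (coordsEquiv A N))).trans
    (Finsupp.linearEquivFunOnFinite (CInfty F)[X] (TateAlg F) (Fin n ⊕ Fin n))

theorem tateCoords_tmul (m : Restr (TMotive A N)) (z : TateAlg F) (i : Fin n ⊕ Fin n) :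
    tateCoords A N (m ⊗ₜ[(CInfty F)[X]] z : Restr (TMotive A N) ⊗[(CInfty F)[X]] TateAlg F) i =
      coordsEquiv A N m i • z :=
  TensorProduct.equivFinsuppOfBasisLeft_apply_tmul_apply _ m z i

theorem tateModule_induction {M : Type} [AddCommGroup M] [Module (AndersonRing F) M]
    {P : TateModule F M → Prop} (zero : P 0) (add : ∀ x y, P x → P y → P (x + y))
    (tmul : ∀ m z, P (m ⊗ₜ[(CInfty F)[X]] z : Restr M ⊗[(CInfty F)[X]] TateAlg F))
    (y : TateModule F M) : P y :=
  TensorProduct.induction_on y zero tmul add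

theorem tateCoords_tau (y : TateModule F (TMotive A N)) :
    tateCoords A N (tateModuleTau F _ y) = twist A N (tateTau F) (tateCoords A N y) := by
  induction y using tateModule_induction with
  | zero => simp only [map_zero]
  | add x y hx hy => simp only [map_add, hx, hy]
  | tmul m z =>
    have h : tateModuleTau F (TMotive A N)
        (m ⊗ₜ[(CInfty F)[X]] z : Restr (TMotive A N) ⊗[(CInfty F)[X]] TateAlg F) =
        (moduleTau F _ m ⊗ₜ[(CInfty F)[X]] tateTau F z :
          Restr (TMotive A N) ⊗[(CInfty F)[X]] TateAlg F) := rfl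
    rw [h]
    ext1 (j | j)
    · rw [tateCoords_tmul, coordsEquiv_tau, twist_inl, twist_inl]
      simp only [tateCoords_tmul, LinearMap.map_smulₛₗ, polyTau_apply, sub_smul, Finset.sum_smul,
        smul_assoc]
    · rw [tateCoords_tmul, coordsEquiv_tau, twist_inr, twist_inr]
      simp only [tateCoords_tmul, LinearMap.map_smulₛₗ, polyTau_apply, sub_smul, Finset.sum_smul,
        smul_assoc]

theorem mem_H1_iff (y : TateModule F (TMotive A N)) :
    y ∈ H1 F (TMotive A N) ↔ twist A N (tateTau F) (tateCoords A N y) = tateCoords A N y := by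
  rw [← tateCoords_tau, (tateCoords A N).injective.eq_iff]
  rfl

end TateCoordinates

/-! ### Elimination of all unknowns but one. -/

section Elimination

variable {K : Type} [NormedField K] [CharP K 2] {θ : K}

-- Here `w` and `v` are the coordinates at `τ e_1` and `τ e_2`. The first equation expresses the
-- Frobenius of `v` through `w`; the Frobenius of the second involves `v` only through its first and
-- third Frobenius twists, so `v` drops out.
open PowerSeries in
theorem equationOp_eq_zero_of_fixed (h0 : θ ≠ 0) {w v : K⟦X⟧}
    (hw : map (frobenius K 2) ((X - C θ) * map (frobenius K 2) w) -
      (C θ * map (frobenius K 2) w + C (θ ^ 6) * map (frobenius K 2) v) = w)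
    (hv : map (frobenius K 2) ((X - C θ) * map (frobenius K 2) v) -
      C (θ ^ 2)⁻¹ * map (frobenius K 2) w = v) : equationOp θ w = 0 := by
  have hs : C θ ^ 2 * C (θ ^ 2)⁻¹ = (1 : K⟦X⟧) := by
    rw [← map_pow, ← map_mul, mul_inv_cancel₀ (pow_ne_zero 2 h0), map_one]
  have hφ : map (frobenius K 2) (C θ : K⟦X⟧) = C θ ^ 2 := by
    rw [map_C, frobenius_def, map_pow]
  have hφs : map (frobenius K 2) (C (θ ^ 2)⁻¹ : K⟦X⟧) = C (θ ^ 2)⁻¹ ^ 2 := by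
    rw [map_C, frobenius_def, map_pow]
  have hw2 := congrArg (fun f => map (frobenius K 2) (map (frobenius K 2) f)) hw
  have hv1 := congrArg (map (frobenius K 2)) hv
  simp only [map_sub, map_add, map_mul, hφ, hφs, map_pow, map_X, ← pow_mul, Nat.reduceMul]
    at hw hw2 hv1
  rw [equationOp]
  linear_combination -(C θ) ^ 18 * hw + C θ ^ 24 * hv1 + (X - C θ ^ 4) * hw2 +
    C θ ^ 20 * map (frobenius K 2) (map (frobenius K 2) w) * (C θ ^ 2 * C (θ ^ 2)⁻¹ + 1) * hs

-- The formula for the Frobenius of `v` is the first equation solved for it; the affine equation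
-- then returns the second.
open PowerSeries in
theorem fixed_of_equationOp_eq_zero (h0 : θ ≠ 0) {w v : K⟦X⟧}
    (hv : map (frobenius K 2) v = C (θ ^ 6)⁻¹ * ((X - C θ ^ 2) *
      map (frobenius K 2) (map (frobenius K 2) w) - C θ * map (frobenius K 2) w - w))
    (h : equationOp θ w = 0) :
    map (frobenius K 2) ((X - C θ) * map (frobenius K 2) w) -
      (C θ * map (frobenius K 2) w + C (θ ^ 6) * map (frobenius K 2) v) = w ∧
    map (frobenius K 2) ((X - C θ) * map (frobenius K 2) v) -
      C (θ ^ 2)⁻¹ * map (frobenius K 2) w = v := by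
  have hs : C θ ^ 2 * C (θ ^ 2)⁻¹ = (1 : K⟦X⟧) := by
    rw [← map_pow, ← map_mul, mul_inv_cancel₀ (pow_ne_zero 2 h0), map_one]
  have hs6 : C (θ ^ 6) * C (θ ^ 6)⁻¹ = (1 : K⟦X⟧) := by
    rw [← map_mul, mul_inv_cancel₀ (pow_ne_zero 6 h0), map_one]
  have hφ : map (frobenius K 2) (C θ : K⟦X⟧) = C θ ^ 2 := by
    rw [map_C, frobenius_def, map_pow]
  have hφs : map (frobenius K 2) (C (θ ^ 2)⁻¹ : K⟦X⟧) = C (θ ^ 2)⁻¹ ^ 2 := by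
    rw [map_C, frobenius_def, map_pow]
  have hw : map (frobenius K 2) ((X - C θ) * map (frobenius K 2) w) -
      (C θ * map (frobenius K 2) w + C (θ ^ 6) * map (frobenius K 2) v) = w := by
    rw [hv, map_mul, map_sub, map_X, hφ]
    linear_combination -((X - C θ ^ 2) * map (frobenius K 2) (map (frobenius K 2) w) -
      C θ * map (frobenius K 2) w - w) * hs6
  refine ⟨hw, ?_⟩
  -- The elimination yields only the Frobenius of the second equation, so injectivity is needed to
  -- descend.
  have hinj : Function.Injective (map (R := K) (frobenius K 2)) :=
    PowerSeries.map_injective _ (frobenius K 2).injective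
  apply hinj
  have hw2 := congrArg (fun f => map (frobenius K 2) (map (frobenius K 2) f)) hw
  refine mul_left_cancel₀ (pow_ne_zero 24 ((map_ne_zero_iff _ C_injective).2 h0)) ?_
  simp only [map_sub, map_add, map_mul, hφ, hφs, map_pow, map_X, ← pow_mul, Nat.reduceMul]
    at hw hw2 ⊢
  rw [equationOp] at h
  linear_combination h + C θ ^ 18 * hw - (X - C θ ^ 4) * hw2 -
    C θ ^ 20 * map (frobenius K 2) (map (frobenius K 2) w) * (C θ ^ 2 * C (θ ^ 2)⁻¹ + 1) * hs

end Elimination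
-- The given affine equation and its small solutions.
section Equation

/-- The zeros and the bracketing are those of the unfolded `lhs`. In the coefficient of `a ^ 4` the
terms `θ ^ 2 / θ ^ 6` and `(θ ^ 2)⁻¹ ^ 2` cancel, which leaves only `θ ^ 4 / (θ ^ 6) ^ 4`. -/
theorem lhs_identity {K : Type} [NormedField K] {θ : K} (h0 : θ ≠ 0) (a b c : K) :
    0 + 1 / θ ^ 6 * a ^ 1 + (θ / θ ^ 6 + 0 ^ 2 / (θ ^ 6) ^ 2) * a ^ 2 +
            (θ ^ 2 / θ ^ 6 + θ ^ 4 / (θ ^ 6) ^ 4 + θ ^ 2 * 0 ^ 2 / (θ ^ 6) ^ 2 -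
                (θ ^ 2)⁻¹ ^ 2) * a ^ 4 +
          ((θ ^ 4 / (θ ^ 6) ^ 4 + 0 ^ 2 / (θ ^ 6) ^ 2) * θ ^ 4 - 0) * a ^ 8 +
        θ ^ 12 / (θ ^ 6) ^ 4 * a ^ 16 +
      (0 + 0 * b ^ 1 + 0 * b ^ 2 + -(1 / θ ^ 6 + 1 / (θ ^ 6) ^ 4) * b ^ 4 +
            -(θ ^ 4 / (θ ^ 6) ^ 4 + 0 ^ 2 / (θ ^ 6) ^ 2) * b ^ 8 +
          -((θ ^ 8 + θ ^ 4) / (θ ^ 6) ^ 4) * b ^ 16 +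
        (0 + 0 * c ^ 1 + 0 * c ^ 2 + 0 * c ^ 4 + 0 * c ^ 8 + 1 / (θ ^ 6) ^ 4 * c ^ 16)) =
      (θ ^ 24)⁻¹ * (head θ a + (tailOne θ b + c ^ 16)) := by
  simp only [head, tailOne]
  field_simp
  ring

theorem lhs_eq (x : ℕ → CInfty F2) (i : ℕ) :
    (affineEquation exampleMatrix.transpose 0).lhs x i =
      (theta F2 ^ 24)⁻¹ * equationAt (theta F2) x i := by
  simp only [AffineEquation.lhs, affineEquation, exampleMatrix, ZMod.card, Finset.sum_range_succ,
    Finset.sum_range_zero, show Finset.Icc 1 2 = {1, 2} from rfl,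
    Finset.sum_pair (show (1 : ℕ) ≠ 2 by norm_num), Matrix.transpose_apply, Matrix.of_apply,
    Matrix.cons_val_zero, Matrix.cons_val_one, Nat.reducePow, Nat.reduceAdd]
  exact lhs_identity (theta_ne_zero F2) _ _ _

theorem lhs_eq_zero_iff (x : ℕ → CInfty F2) (i : ℕ) :
    (affineEquation exampleMatrix.transpose 0).lhs x i = 0 ↔ equationAt (theta F2) x i = 0 := by
  rw [lhs_eq, mul_eq_zero, or_iff_right (inv_ne_zero (pow_ne_zero 24 (theta_ne_zero F2)))]

theorem isSolution_iff (x : (CInfty F2)⟦X⟧) :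
    (affineEquation exampleMatrix.transpose 0).IsSolution x ↔ equationOp (theta F2) x = 0 := by
  simp only [AffineEquation.IsSolution, lhs_eq_zero_iff, equationOp_eq_zero_iff]

theorem ord_eq_one_iff (x : CInfty F2) : ord x = 1 ↔ ‖x‖ = 1 / 2 := by
  rw [← WithTop.coe_one, ord_eq_iff, Real.rpow_neg_one, one_div]

theorem IsChain.isMinimalChain {x : (CInfty F2)⟦X⟧}
    (hx : IsChain (theta F2) fun j => PowerSeries.coeff j x) :
    (affineEquation exampleMatrix.transpose 0).IsMinimalChain x := by
  refine ⟨(isSolution_iff x).2 (equationOp_eq_zero_iff.2 hx.equationAt_eq_zero),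
    fun i hi z hz => ?_⟩
  rw [ord_le_ord_iff]
  exact hx.norm_le norm_theta_two hi ((lhs_eq_zero_iff _ i).1 hz)

theorem isChain_of_isMinimalChain {x : (CInfty F2)⟦X⟧}
    (hx : (affineEquation exampleMatrix.transpose 0).IsMinimalChain x)
    (h0 : ord (PowerSeries.coeff 0 x) = 1) :
    IsChain (theta F2) fun j => PowerSeries.coeff j x := by
  refine isChain_of_norm_le norm_theta_two (fun i => (lhs_eq_zero_iff _ i).1 (hx.1 i))
    ((ord_eq_one_iff _).1 h0) fun i hi z hz => ?_
  rw [← ord_le_ord_iff]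
  exact hx.2 i hi z ((lhs_eq_zero_iff _ i).2 hz)

theorem IsChain.ord_eq {x : (CInfty F2)⟦X⟧}
    (hx : IsChain (theta F2) fun j => PowerSeries.coeff j x) (n : ℕ) :
    ord (PowerSeries.coeff n x) = ((4 ^ n : ℝ) : WithTop ℝ) := by
  rw [ord_eq_iff, hx.norm_eq norm_theta_two n, Real.rpow_neg (by norm_num), one_div, inv_pow,
    ← Real.rpow_natCast 2 (4 ^ n)]
  push_cast
  rfl

theorem IsChain.mem_tateAlg {x : (CInfty F2)⟦X⟧}
    (hx : IsChain (theta F2) fun j => PowerSeries.coeff j x) : x ∈ TateAlg F2 := by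
  rw [Anderson.mem_tateAlg, tendsto_zero_iff_norm_tendsto_zero]
  simp only [hx.norm_eq norm_theta_two]
  exact (tendsto_pow_atTop_nhds_zero_of_lt_one (by norm_num) (by norm_num)).comp
    (Filter.tendsto_atTop_mono (fun n => (Nat.lt_pow_self (by norm_num)).le) Filter.tendsto_id)

theorem algebraMap_mem_tateAlg (p : F2[X]) :
    algebraMap F2[X] (CInfty F2)⟦X⟧ p ∈ TateAlg F2 := by
  have h : algebraMap F2[X] (CInfty F2)⟦X⟧ p =
      ((algebraMap (CInfty F2)[X] (TateAlg F2) (constIncl F2 p) : TateAlg F2) :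
        (CInfty F2)⟦X⟧) := by
    change _ = algebraMap (CInfty F2)[X] (CInfty F2)⟦X⟧ (constIncl F2 p)
    ext i
    simp [PowerSeries.algebraMap_apply', constIncl]
  rw [h]
  exact Subtype.property _

theorem IsChain.smallSolutions_eq {x : (CInfty F2)⟦X⟧}
    (hx : IsChain (theta F2) fun j => PowerSeries.coeff j x) :
    (affineEquation exampleMatrix.transpose 0).smallSolutions =
      (Submodule.span F2[X] {x} : Set (CInfty F2)⟦X⟧) := by
  ext f
  rw [SetLike.mem_coe, Submodule.mem_span_singleton, AffineEquation.smallSolutions,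
    Set.mem_ofPred_eq, isSolution_iff]
  constructor
  · rintro ⟨hf, hf'⟩
    rw [Anderson.mem_tateAlg, tendsto_zero_iff_norm_tendsto_zero] at hf'
    obtain ⟨N, hN⟩ := Filter.eventually_atTop.1 (hf'.eventually (gt_mem_nhds one_half_pos))
    exact hx.exists_smul_eq norm_theta_two N hf hN
  · rintro ⟨p, rfl⟩
    refine ⟨?_, ?_⟩
    · rw [equationOp_smul, equationOp_eq_zero_iff.2 hx.equationAt_eq_zero, smul_zero]
    · rw [Algebra.smul_def]
      exact mul_mem (algebraMap_mem_tateAlg p) hx.mem_tateAlg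

theorem frob_eq_frobenius : frob F2 = frobenius (CInfty F2) 2 := by
  ext x
  rw [frob_two, frobenius_def]

end Equation

/-! ### Identification of `H^1` with the small solutions. -/

section FirstCohomology

section Coordinates

variable {F : Type} [Field F] [Fintype F]

theorem coe_smul_tateAlg (p : (CInfty F)[X]) (z : TateAlg F) :
    ((p • z : TateAlg F) : (CInfty F)⟦X⟧) = (p : (CInfty F)⟦X⟧) * z := by
  change algebraMap (CInfty F)[X] (CInfty F)⟦X⟧ p * (z : (CInfty F)⟦X⟧) = _
  rw [PowerSeries.algebraMap_apply', Algebra.algebraMap_self, PowerSeries.map_id]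
  rfl

theorem coe_constIncl (p : F[X]) : ((constIncl F p : (CInfty F)[X]) : (CInfty F)⟦X⟧) =
    algebraMap F[X] (CInfty F)⟦X⟧ p := by
  ext i
  simp [PowerSeries.algebraMap_apply', constIncl]

variable {n : ℕ} (A N : Matrix (Fin n) (Fin n) (CInfty F))

theorem tateCoords_smul (p : F[X]) (y : TateModule F (TMotive A N)) :
    tateCoords A N (p • y) = constIncl F p • tateCoords A N y :=
  map_smul (tateCoords A N) (constIncl F p) y

/-- The `i`-th coordinate on `H^1(M(A, N))`. -/
def coordH1 (i : Fin n ⊕ Fin n) : H1 F (TMotive A N) →ₗ[F[X]] (CInfty F)⟦X⟧ where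
  toFun y := (tateCoords A N y.1 i : TateAlg F)
  map_add' y z := by
    rw [Submodule.coe_add, map_add, Pi.add_apply, AddMemClass.coe_add]
  map_smul' p y := by
    rw [Submodule.coe_smul, tateCoords_smul, Pi.smul_apply, coe_smul_tateAlg, coe_constIncl,
      RingHom.id_apply, Algebra.smul_def]

end Coordinates

theorem coe_tateTau (z : TateAlg F2) :
    (tateTau F2 z : (CInfty F2)⟦X⟧) = PowerSeries.map (frobenius (CInfty F2) 2) z := by
  rw [← frob_eq_frobenius]
  rfl

theorem exampleMatrix_transpose_zero_zero : exampleMatrix.transpose 0 0 = theta F2 := by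
  simp [exampleMatrix]

theorem exampleMatrix_transpose_zero_one :
    exampleMatrix.transpose 0 1 = (theta F2 ^ 2)⁻¹ := by
  simp [exampleMatrix]

theorem exampleMatrix_transpose_one_zero : exampleMatrix.transpose 1 0 = theta F2 ^ 6 := by
  simp [exampleMatrix]

theorem exampleMatrix_transpose_one_one : exampleMatrix.transpose 1 1 = 0 := by
  simp [exampleMatrix]

theorem twist_inl_example (w : Fin 2 ⊕ Fin 2 → TateAlg F2) (j : Fin 2) :
    (twist exampleMatrix.transpose 0 (tateTau F2) w (.inl j) : (CInfty F2)⟦X⟧) =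
      (PowerSeries.X - PowerSeries.C (theta F2)) *
        PowerSeries.map (frobenius (CInfty F2) 2) (w (.inr j)) := by
  rw [twist_inl]
  have h : ∑ i, (Polynomial.C (constMatrix 0 i j) : (CInfty F2)[X]) • tateTau F2 (w (.inr i)) =
      (Polynomial.C (theta F2) : (CInfty F2)[X]) • tateTau F2 (w (.inr j)) := by
    have hne : ∀ i, i ≠ j → constMatrix (F := F2) 0 i j = 0 := fun i hij => by
      simp [constMatrix, Matrix.one_apply_ne hij]
    have heq : constMatrix (F := F2) 0 j j = theta F2 := by simp [constMatrix]
    rw [Finset.sum_eq_single j, heq]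
    · intro i _ hij
      rw [hne i hij, map_zero, zero_smul]
    · exact fun hj => absurd (Finset.mem_univ j) hj
  rw [h, AddSubgroupClass.coe_sub, coe_smul_tateAlg, coe_smul_tateAlg, coe_tateTau,
    Polynomial.coe_X, Polynomial.coe_C, sub_mul]

theorem twist_inr_example_zero (w : Fin 2 ⊕ Fin 2 → TateAlg F2) :
    (twist exampleMatrix.transpose 0 (tateTau F2) w (.inr 0) : (CInfty F2)⟦X⟧) =
      PowerSeries.map (frobenius (CInfty F2) 2) (w (.inl 0)) -
        (PowerSeries.C (theta F2) * PowerSeries.map (frobenius (CInfty F2) 2) (w (.inr 0)) +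
          PowerSeries.C (theta F2 ^ 6) *
            PowerSeries.map (frobenius (CInfty F2) 2) (w (.inr 1))) := by
  rw [twist_inr, Fin.sum_univ_two, AddSubgroupClass.coe_sub, AddMemClass.coe_add, coe_smul_tateAlg,
    coe_smul_tateAlg, coe_tateTau, coe_tateTau, coe_tateTau, Polynomial.coe_C, Polynomial.coe_C,
    exampleMatrix_transpose_zero_zero, exampleMatrix_transpose_one_zero]

theorem twist_inr_example_one (w : Fin 2 ⊕ Fin 2 → TateAlg F2) :
    (twist exampleMatrix.transpose 0 (tateTau F2) w (.inr 1) : (CInfty F2)⟦X⟧) =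
      PowerSeries.map (frobenius (CInfty F2) 2) (w (.inl 1)) -
        PowerSeries.C (theta F2 ^ 2)⁻¹ *
          PowerSeries.map (frobenius (CInfty F2) 2) (w (.inr 0)) := by
  rw [twist_inr, Fin.sum_univ_two, AddSubgroupClass.coe_sub, AddMemClass.coe_add, coe_smul_tateAlg,
    coe_smul_tateAlg, coe_tateTau, coe_tateTau, coe_tateTau, Polynomial.coe_C, Polynomial.coe_C]
  rw [exampleMatrix_transpose_zero_one, exampleMatrix_transpose_one_one, map_zero, zero_mul,
    add_zero]

open PowerSeries in
/-- The equations of `H^1(M(Aᵗ))` in coordinates. -/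
theorem twist_example_eq_iff (w : Fin 2 ⊕ Fin 2 → TateAlg F2) :
    twist exampleMatrix.transpose 0 (tateTau F2) w = w ↔
      (∀ j, ((X - C (theta F2)) * map (frobenius (CInfty F2) 2) (w (.inr j)) =
        (w (.inl j) : (CInfty F2)⟦X⟧))) ∧
      (map (frobenius (CInfty F2) 2) (w (.inl 0)) -
        (C (theta F2) * map (frobenius (CInfty F2) 2) (w (.inr 0)) +
          C (theta F2 ^ 6) * map (frobenius (CInfty F2) 2) (w (.inr 1))) =
        (w (.inr 0) : (CInfty F2)⟦X⟧)) ∧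
      (map (frobenius (CInfty F2) 2) (w (.inl 1)) -
        C (theta F2 ^ 2)⁻¹ * map (frobenius (CInfty F2) 2) (w (.inr 0)) =
        (w (.inr 1) : (CInfty F2)⟦X⟧)) := by
  rw [← twist_inr_example_zero, ← twist_inr_example_one]
  simp only [← twist_inl_example]
  constructor
  · intro h
    rw [h]
    exact ⟨fun _ => rfl, rfl, rfl⟩
  · rintro ⟨h1, h2, h3⟩
    ext1 (j | j)
    · exact Subtype.ext (h1 j)
    · fin_cases j
      · exact Subtype.ext h2
      · exact Subtype.ext h3

/-- If the coordinate at `τ e_1` vanishes, so does the one at `e_1`; as `θ ^ 6 ≠ 0`, the first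
equation kills the coordinate at `τ e_2`, and with it the one at `e_2`. -/
theorem coordH1_injective :
    Function.Injective (coordH1 exampleMatrix.transpose 0 (.inr 0)) := by
  rw [injective_iff_map_eq_zero]
  rintro ⟨y, hy⟩ h0
  have h : ((tateCoords exampleMatrix.transpose 0 y (.inr 0) : TateAlg F2) :
    (CInfty F2)⟦X⟧) = 0 := h0
  obtain ⟨h1, h2, -⟩ := (twist_example_eq_iff _).1 ((mem_H1_iff _ _ y).1 hy)
  have hu := h1 0
  rw [h, map_zero, mul_zero] at hu
  rw [h, ← hu, map_zero, mul_zero, zero_add, zero_sub, neg_eq_zero, mul_eq_zero,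
    map_eq_zero_iff _ PowerSeries.C_injective] at h2
  have hv := (map_eq_zero_iff _ (PowerSeries.map_injective _ (frobenius (CInfty F2) 2).injective)).1
    (h2.resolve_left (pow_ne_zero 6 (theta_ne_zero F2)))
  have hu' := h1 1
  rw [hv, map_zero, mul_zero] at hu'
  have hw : tateCoords exampleMatrix.transpose 0 y = 0 := by
    ext1 (j | j) <;> fin_cases j
    · exact Subtype.ext hu.symm
    · exact Subtype.ext hu'.symm
    · exact Subtype.ext h
    · exact Subtype.ext hv
  exact Subtype.ext ((tateCoords exampleMatrix.transpose 0).map_eq_zero_iff.1 hw)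

/-- If the Frobenius is surjective, then every power series with coefficients tending to zero is the
image of such a power series. -/
theorem exists_map_frobenius_eq {K : Type} [NormedField K] [CharP K 2]
    (hs : Function.Surjective (frobenius K 2)) {z : K⟦X⟧}
    (hz : Filter.Tendsto (fun i => PowerSeries.coeff i z) Filter.atTop (nhds 0)) :
    ∃ v : K⟦X⟧, PowerSeries.map (frobenius K 2) v = z ∧
      Filter.Tendsto (fun i => PowerSeries.coeff i v) Filter.atTop (nhds 0) := by
  choose g hg using hs
  refine ⟨PowerSeries.mk fun i => g (PowerSeries.coeff i z), ?_, ?_⟩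
  · ext i
    rw [PowerSeries.coeff_map, PowerSeries.coeff_mk, hg]
  · rw [tendsto_zero_iff_norm_tendsto_zero] at hz ⊢
    have hsq : ∀ a, ‖g a‖ = √‖a‖ := fun a => by
      conv_rhs => rw [← hg a, frobenius_def, norm_pow, Real.sqrt_sq (norm_nonneg _)]
    simp only [PowerSeries.coeff_mk, hsq]
    have := (Real.continuous_sqrt.tendsto 0).comp hz
    rwa [Real.sqrt_zero] at this

/-- The Frobenius is surjective on `C_∞{T}`. -/
theorem tateTau_surjective : Function.Surjective (tateTau F2) := by
  intro z
  obtain ⟨v, hv, hv'⟩ := exists_map_frobenius_eq (frob_eq_frobenius ▸ frob_surjective F2)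
    ((mem_tateAlg F2).1 z.2)
  exact ⟨⟨v, (mem_tateAlg F2).2 hv'⟩, Subtype.ext ((coe_tateTau _).trans hv)⟩

theorem range_coordH1 :
    (LinearMap.range (coordH1 exampleMatrix.transpose 0 (.inr 0)) : Set (CInfty F2)⟦X⟧) =
      (affineEquation exampleMatrix.transpose 0).smallSolutions := by
  ext f
  rw [SetLike.mem_coe, LinearMap.mem_range, AffineEquation.smallSolutions, Set.mem_ofPred_eq,
    isSolution_iff]
  constructor
  · rintro ⟨⟨y, hy⟩, rfl⟩
    obtain ⟨h1, h2, h3⟩ := (twist_example_eq_iff _).1 ((mem_H1_iff _ _ y).1 hy)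
    rw [← h1] at h2 h3
    exact ⟨equationOp_eq_zero_of_fixed (theta_ne_zero F2) h2 h3, Subtype.property _⟩
  · rintro ⟨hf, hf'⟩
    let w : TateAlg F2 := ⟨f, hf'⟩
    -- The elimination prescribes only the Frobenius of `v`; surjectivity on `C_∞{T}` yields a `v`
    -- that is again in `C_∞{T}`.
    obtain ⟨v, hv⟩ := tateTau_surjective ((Polynomial.C (theta F2 ^ 6)⁻¹ : (CInfty F2)[X]) •
      ((Polynomial.X - Polynomial.C (theta F2) ^ 2 : (CInfty F2)[X]) • tateTau F2 (tateTau F2 w) -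
        (Polynomial.C (theta F2) : (CInfty F2)[X]) • tateTau F2 w - w))
    have hv' := congrArg (fun z : TateAlg F2 => (z : (CInfty F2)⟦X⟧)) hv
    simp only [coe_tateTau, coe_smul_tateAlg, AddSubgroupClass.coe_sub, Polynomial.coe_sub,
      Polynomial.coe_X, Polynomial.coe_C, Polynomial.coe_pow] at hv'
    obtain ⟨h1, h2⟩ := fixed_of_equationOp_eq_zero (theta_ne_zero F2) hv' hf
    let u : TateAlg F2 → TateAlg F2 := fun z =>
      (Polynomial.X - Polynomial.C (theta F2) : (CInfty F2)[X]) • tateTau F2 z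
    have hu : ∀ z, (u z : (CInfty F2)⟦X⟧) = (PowerSeries.X - PowerSeries.C (theta F2)) *
        PowerSeries.map (frobenius (CInfty F2) 2) z := by
      intro z
      simp only [u, coe_tateTau, coe_smul_tateAlg, Polynomial.coe_sub, Polynomial.coe_X,
        Polynomial.coe_C]
    let W : Fin 2 ⊕ Fin 2 → TateAlg F2 := Sum.elim ![u w, u v] ![w, v]
    have hW : twist exampleMatrix.transpose 0 (tateTau F2) W = W := by
      rw [twist_example_eq_iff]
      refine ⟨fun j => ?_, ?_, ?_⟩
      · fin_cases j
        · exact (hu w).symm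
        · exact (hu v).symm
      · change PowerSeries.map _ (u w : (CInfty F2)⟦X⟧) - _ = _
        rw [hu]
        exact h1
      · change PowerSeries.map _ (u v : (CInfty F2)⟦X⟧) - _ = _
        rw [hu]
        exact h2
    refine ⟨⟨(tateCoords exampleMatrix.transpose 0).symm W, ?_⟩, ?_⟩
    · rw [mem_H1_iff, LinearEquiv.apply_symm_apply, hW]
    · change ((tateCoords exampleMatrix.transpose 0
        ((tateCoords exampleMatrix.transpose 0).symm W) (.inr 0) : TateAlg F2) :
          (CInfty F2)⟦X⟧) = f
      rw [LinearEquiv.apply_symm_apply]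
      rfl

/-- `H^1(M(Aᵗ))` is generated by the solution given by a chain. -/
theorem IsChain.nonempty_H1_equiv {x : (CInfty F2)⟦X⟧}
    (hx : IsChain (theta F2) fun j => PowerSeries.coeff j x) :
    Nonempty (F2[X] ≃ₗ[F2[X]] H1 F2 (TMotive exampleMatrix.transpose 0)) := by
  have hrange : LinearMap.range (coordH1 exampleMatrix.transpose 0 (.inr 0)) =
      Submodule.span F2[X] {x} :=
    SetLike.coe_injective (range_coordH1.trans hx.smallSolutions_eq)
  have hx0 : x ≠ 0 := by
    rintro rfl
    have := hx.norm_zero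
    simp at this
  -- The power series ring is a domain and `x ≠ 0`, so `x` has no `𝔽_2[T]`-torsion and its span is
  -- free of rank one.
  have hinj : Function.Injective (LinearMap.toSpanSingleton F2[X] (CInfty F2)⟦X⟧ x) := by
    rw [injective_iff_map_eq_zero]
    intro p hp
    rw [LinearMap.toSpanSingleton_apply, Algebra.smul_def, mul_eq_zero, or_iff_left hx0] at hp
    ext i
    have := congrArg (PowerSeries.coeff i) hp
    rw [PowerSeries.algebraMap_apply', PowerSeries.coeff_map, map_zero,
      map_eq_zero_iff _ (algebraMap F2 (CInfty F2)).injective] at this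
    simpa using this
  exact ⟨(LinearEquiv.ofInjective _ hinj).trans ((LinearEquiv.ofEq _ _
    ((LinearMap.range_toSpanSingleton x).trans hrange.symm)).trans
      (LinearEquiv.ofInjective _ coordH1_injective).symm)⟩

end FirstCohomology

end Anderson

end

open Polynomial Matrix in
/-- For `q = 2`, the t-motive `M(Aᵗ)` has `h^1 = 1`. The affine equation associated to it has a
minimal chain `{x_1}` with `ord x_10 = 1`, every such chain satisfies `ord x_1n = 4 ^ n` for all
`n`, and the set of small solutions is `𝔽_2[T] {x_1}`. -/
theorem theorem4p7 :
    (Module.Free Anderson.F2[X]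
        (Anderson.H1 Anderson.F2 (Anderson.TMotive (Anderson.exampleMatrixᵀ) 0)) ∧
      Anderson.h1 Anderson.F2 (Anderson.TMotive (Anderson.exampleMatrixᵀ) 0) = 1) ∧
    (∃ x₁ : PowerSeries (Anderson.CInfty Anderson.F2),
      (Anderson.affineEquation (Anderson.exampleMatrixᵀ) 0).IsMinimalChain x₁ ∧
        Anderson.ord (PowerSeries.coeff 0 x₁) = 1) ∧
    ∀ x₁ : PowerSeries (Anderson.CInfty Anderson.F2),
      (Anderson.affineEquation (Anderson.exampleMatrixᵀ) 0).IsMinimalChain x₁ →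
      Anderson.ord (PowerSeries.coeff 0 x₁) = 1 →
        (∀ n : ℕ, Anderson.ord (PowerSeries.coeff n x₁) = ((4 ^ n : ℝ) : WithTop ℝ)) ∧
        (Anderson.affineEquation (Anderson.exampleMatrixᵀ) 0).smallSolutions =
          (Submodule.span Anderson.F2[X] {x₁} :
            Set (PowerSeries (Anderson.CInfty Anderson.F2))) := by
  have hex : ∃ x : PowerSeries (Anderson.CInfty Anderson.F2),
      Anderson.IsChain (Anderson.theta Anderson.F2) fun j => PowerSeries.coeff j x := by
    obtain ⟨x, hx⟩ := Anderson.exists_isChain Anderson.norm_theta_two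
    exact ⟨PowerSeries.mk x, by simpa only [PowerSeries.coeff_mk] using hx⟩
  obtain ⟨x, hx⟩ := hex
  obtain ⟨e⟩ := hx.nonempty_H1_equiv
  refine ⟨⟨Module.Free.of_equiv e, ?_⟩,
    ⟨x, hx.isMinimalChain, (Anderson.ord_eq_one_iff _).2 hx.norm_zero⟩, fun x₁ h₁ h0 => ?_⟩
  · rw [Anderson.h1, ← e.finrank_eq, Module.finrank_self]
  · have hc := Anderson.isChain_of_isMinimalChain h₁ h0
    exact ⟨hc.ord_eq, hc.smallSolutions_eq⟩
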